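/- Let $n\ge 2$. A polynomial vector field $\dot x=P(x,y)$, $\dot y=Q(x,y)$ on $\mathbb{C}^2$ (with complex time), $\deg P,\deg Q\le n$, $P$ and $Q$ coprime, defines a singular holomorphic foliation of $\mathbb{C}^2$; its leaves are the nonconstant complex trajectories, considered as Riemann surfaces with their intrinsic topology. Proportional vector fields define the same foliation, so the space $\mathcal{A}_n$ of these foliations is a subset of the projective space of dimension $(n+1)(n+2)-1$, and it carries the induced topology. Let $\mathcal{A}_n^h\subset\mathcal{A}_n$ be the subspace of the foliations given by homogeneous polynomials $P,Q$ of degree $n$. A Riemann surface has at least $g$ handles if there are $g$ pairs of closed loops on it such that the two loops of each pair intersect transversally at exactly one point (which each of them passes exactly once) and loops from different pairs do not intersect; it has infinite genus if it has at least $g$ handles for every integer $g\ge 0$. Then there is an open dense subset $U$ of $\mathcal{A}_n^h$ such that for every foliation $\mathcal{F}\in U$ all leaves of $\mathcal{F}$, except for finitely many, have infinite genus. -/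

import Mathlib

open scoped LinearAlgebra.Projectivization Topology

noncomputable section

namespace PolyFol

/-- Polynomials in the two complex variables `x = X 0` and `y = X 1`. -/
abbrev Poly : Type := MvPolynomial (Fin 2) ℂ

/-! ### The spaces of foliations -/

/-- The vector space of polynomial vector fields `ẋ = P(x, y)`, `ẏ = Q(x, y)` on `ℂ²` with
`deg P ≤ n` and `deg Q ≤ n`; an element is the pair `(P, Q)`. -/
abbrev VF (n : ℕ) : Type :=
  MvPolynomial.restrictTotalDegree (Fin 2) ℂ n × MvPolynomial.restrictTotalDegree (Fin 2) ℂ n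

/-- The family of all coefficients of a polynomial vector field. -/
def coeffs (n : ℕ) (X : VF n) : (Fin 2 →₀ ℕ) → ℂ × ℂ :=
  fun m => (MvPolynomial.coeff m (X.1 : Poly), MvPolynomial.coeff m (X.2 : Poly))

/-- The usual topology of the finite-dimensional complex vector space `VF n`:
convergence of the coefficients. -/
abbrev coeffTopology (n : ℕ) : TopologicalSpace (VF n) :=
  TopologicalSpace.induced (coeffs n) inferInstance

/-- The projective space of vector fields of degree at most `n` up to proportionality. -/
abbrev ProjVF (n : ℕ) : Type := ℙ ℂ (VF n)

/-- The projective space carries the quotient topology of `VF n ∖ {0}`. -/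
instance projTopology (n : ℕ) : TopologicalSpace (ProjVF n) :=
  TopologicalSpace.coinduced (Projectivization.mk' ℂ : {X : VF n // X ≠ 0} → ProjVF n)
    (@instTopologicalSpaceSubtype _ (fun X : VF n => X ≠ 0) (coeffTopology n))

/-- The vector field `X` represents the point `F` of the projective space. -/
def Represents {n : ℕ} (X : VF n) (F : ProjVF n) : Prop :=
  ∃ hX : X ≠ 0, Projectivization.mk ℂ X hX = F

/-- The space `𝒜_n` of foliations of `ℂ²` given by vector fields of degree at most `n`
with coprime components (that is, without a nonconstant common factor). -/
def foliations (n : ℕ) : Set (ProjVF n) :=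
  {F | ∃ X : VF n, Represents X F ∧ IsRelPrime (X.1 : Poly) (X.2 : Poly)}

/-- The space `𝒜_n^h ⊆ 𝒜_n` of foliations given by homogeneous polynomials of degree `n`. -/
def homogeneousFoliations (n : ℕ) : Set (ProjVF n) :=
  {F | F ∈ foliations n ∧ ∃ X : VF n, Represents X F ∧
    MvPolynomial.IsHomogeneous (X.1 : Poly) n ∧ MvPolynomial.IsHomogeneous (X.2 : Poly) n}

/-! ### Leaves -/

/-- The value at `p` of the vector field `(P, Q)`. -/
def field (P Q : Poly) (p : ℂ × ℂ) : ℂ × ℂ :=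
  (MvPolynomial.eval ![p.1, p.2] P, MvPolynomial.eval ![p.1, p.2] Q)

/-- A holomorphic integral curve (in complex time) of the vector field `(P, Q)`, defined on an
open subset of the complex time line; the values of `toFun` off `domain` are irrelevant. -/
structure IntegralCurve (P Q : Poly) where
  domain : Set ℂ
  isOpen_domain : IsOpen domain
  toFun : ℂ → ℂ × ℂ
  hasDerivAt : ∀ t ∈ domain, HasDerivAt toFun (field P Q (toFun t)) t

/-- The leaf topology on `ℂ²`: the finest topology for which all integral curves are continuous.
Away from the singular points its basic open sets are the plaques, that is, the images of small
discs under integral curves, so it restricts to each leaf as the topology of the leaf as a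
Riemann surface (in general finer than the one induced from `ℂ²`). -/
abbrev leafTopology (P Q : Poly) : TopologicalSpace (ℂ × ℂ) :=
  ⨆ φ : IntegralCurve P Q,
    TopologicalSpace.coinduced (fun t : φ.domain => φ.toFun t) inferInstance

/-- The leaves of the foliation given by `(P, Q)`: the connected components, in the leaf topology,
of the nonsingular points. -/
def IsLeaf (P Q : Poly) (L : Set (ℂ × ℂ)) : Prop :=
  ∃ p : ℂ × ℂ, field P Q p ≠ 0 ∧ L = @connectedComponent _ (leafTopology P Q) p

/-! ### Handles and genus -/

/-- A closed loop on the leaf `L`, written as a `1`-periodic map of the real line which is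
continuous for the leaf topology. -/
def IsLoopOn (P Q : Poly) (L : Set (ℂ × ℂ)) (c : ℝ → ℂ × ℂ) : Prop :=
  Function.Periodic c 1 ∧ @Continuous _ _ _ (leafTopology P Q) c ∧ ∀ t, c t ∈ L

/-- The loops `a`, `b` on a leaf intersect at exactly one point (passed by each of them exactly once
in a period), and transversally: near this point they are continuously differentiable, and their
velocities there are linearly independent over the reals (both velocities lie in the
tangent line of the leaf, a real plane). -/
def MeetTransversallyOnce (a b : ℝ → ℂ × ℂ) : Prop :=
  ∃ s ∈ Set.Ico (0 : ℝ) 1, ∃ t ∈ Set.Ico (0 : ℝ) 1,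
    a s = b t ∧
    (∀ s' ∈ Set.Ico (0 : ℝ) 1, ∀ t' ∈ Set.Ico (0 : ℝ) 1, a s' = b t' → s' = s ∧ t' = t) ∧
    ContDiffAt ℝ 1 a s ∧ ContDiffAt ℝ 1 b t ∧
    LinearIndependent ℝ ![deriv a s, deriv b t]

/-- The leaf `L` has at least `g` handles: it carries `g` pairs of closed loops such that the loops
of each pair intersect transversally at exactly one point and loops from different pairs
do not intersect. -/
def HasAtLeastHandles (P Q : Poly) (L : Set (ℂ × ℂ)) (g : ℕ) : Prop :=
  ∃ a b : Fin g → ℝ → ℂ × ℂ,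
    (∀ j, IsLoopOn P Q L (a j) ∧ IsLoopOn P Q L (b j) ∧ MeetTransversallyOnce (a j) (b j)) ∧
    ∀ i j, i ≠ j →
      Disjoint (Set.range (a i) ∪ Set.range (b i)) (Set.range (a j) ∪ Set.range (b j))

/-- The leaf `L` has infinite genus. -/
def HasInfiniteGenus (P Q : Poly) (L : Set (ℂ × ℂ)) : Prop :=
  ∀ g : ℕ, HasAtLeastHandles P Q L g

end PolyFol

end

noncomputable section

namespace PolyFol

/-! ### The leaf topology -/

/-! In the coordinate z = x / y a homogeneous field gives d(log y)/dz = Q(z,1) / (P(z,1) - z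
Q(z,1)), which is `slope`. Off the invariant lines, which are the zeros of `den` and possibly y = 0,
a leaf is thus y = C exp(∫ slope dz), continued along paths that avoid the zeros of `den`. A closed
path multiplies y by a constant. These multipliers commute, so a commutator of two loops lifts to a
closed loop on the leaf.

Take a figure eight whose two lobes have periods a and b. The lift of the commutator of the lobes
(`doubleLift`) passes over the crossing with the factors C e^b, C, C e^a, C e^(a+b). Scaling it by
e^(-(a+b)) gives a second loop that also passes through the factor C, on the other branch of the
eight. By comparing log |y|, the two loops meet nowhere else if the real parts of a, b, a + b, 2a +
b and a + 2b are nonzero (`doubleLift_eq_doubleLift`). This is one handle. Multiplication by high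
powers of e^a keeps the leaf and moves the handle to a different range of |y|, so there are
infinitely many disjoint handles (`IsGoodContour.hasInfiniteGenus`). Every leaf off the invariant
lines reaches the fibre over the crossing, and each invariant line without the origin lies in one
leaf (`IsGoodContour.finite_leaves`).

For a fixed figure eight the conditions are open (`isOpen_setOf_isGoodContour`). For density, write
the field as (p, q) on y = 1 and put R = p - X q. Three small perturbations suffice: one gives R
degree n + 1 and simple roots, one makes q nonzero at these roots, and one keeps R and shifts both
periods by a real δ. The last uses a third root of R (`exists_contour`), which exists because n + 1
≥ 3. -/

/-- The plane with the leaf topology. -/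
def LeafSpace (_P _Q : Poly) : Type := ℂ × ℂ

instance (P Q : Poly) : TopologicalSpace (LeafSpace P Q) := leafTopology P Q

/-- The identity map onto the plane with the leaf topology. -/
def toLeaf (P Q : Poly) (p : ℂ × ℂ) : LeafSpace P Q := p

/-- The connected component of `p` in the leaf topology. -/
def leaf (P Q : Poly) (p : ℂ × ℂ) : Set (ℂ × ℂ) :=
  {p' | toLeaf P Q p' ∈ connectedComponent (toLeaf P Q p)}

theorem mem_leaf_of_image {P Q : Poly} {X : Type*} [TopologicalSpace X] {S : Set X}
    (hS : IsPreconnected S) {c : X → ℂ × ℂ} (hc : ContinuousOn (fun x => toLeaf P Q (c x)) S)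
    {p : ℂ × ℂ} {x y : X} (hx : x ∈ S) (hxp : c x ∈ leaf P Q p) (hy : y ∈ S) :
    c y ∈ leaf P Q p := by
  have h := (hS.image _ hc).subset_connectedComponent (Set.mem_image_of_mem _ hx)
    (Set.mem_image_of_mem _ hy)
  have hxp' : toLeaf P Q (c x) ∈ connectedComponent (toLeaf P Q p) := hxp
  rw [← connectedComponent_eq hxp'] at h
  exact h

theorem mem_leaf_self (P Q : Poly) (p : ℂ × ℂ) : p ∈ leaf P Q p :=
  mem_connectedComponent (x := toLeaf P Q p)

theorem leaf_eq {P Q : Poly} {p p' : ℂ × ℂ} (h : p' ∈ leaf P Q p) :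
    leaf P Q p = leaf P Q p' := by
  have h' : toLeaf P Q p' ∈ connectedComponent (toLeaf P Q p) := h
  simp only [leaf, connectedComponent_eq h']

theorem IntegralCurve.continuous {P Q : Poly} (φ : IntegralCurve P Q) :
    Continuous (fun t : φ.domain => toLeaf P Q (φ.toFun t)) :=
  continuous_iff_coinduced_le.2
    (le_iSup (fun φ : IntegralCurve P Q =>
      TopologicalSpace.coinduced (fun t : φ.domain => φ.toFun t) inferInstance) φ)

/-- A holomorphic curve whose velocity is a nonvanishing holomorphic multiple of the vector field
is continuous for the leaf topology. -/
theorem continuousOn_leafSpace {P Q : Poly} {S : Set ℂ} (hS : IsOpen S) {ψ : ℂ → ℂ × ℂ} {h : ℂ → ℂ}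
    (hh : DifferentiableOn ℂ h S) (h0 : ∀ w ∈ S, h w ≠ 0)
    (hψ : ∀ w ∈ S, HasDerivAt ψ (h w • field P Q (ψ w)) w) :
    ContinuousOn (fun w => toLeaf P Q (ψ w)) S := by
  intro w₀ hw₀
  refine ContinuousAt.continuousWithinAt ?_
  obtain ⟨r, hr, hrS⟩ := Metric.isOpen_iff.1 hS w₀ hw₀
  obtain ⟨T, hT⟩ := (hh.mono hrS).isExactOn_ball
  have hTd : DifferentiableOn ℂ T (Metric.ball w₀ r) :=
    fun w hw => (hT w hw).differentiableAt.differentiableWithinAt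
  have hw₀r := Metric.mem_ball_self (x := w₀) hr
  have hTc : ContDiffAt ℂ 1 T w₀ :=
    ((hTd.analyticAt (Metric.isOpen_ball.mem_nhds hw₀r))).contDiffAt
  have hTs : HasStrictDerivAt T (h w₀) w₀ := by
    have := hTc.hasStrictDerivAt (by norm_num)
    rwa [(hT w₀ hw₀r).deriv] at this
  let e₀ := (hTs.hasStrictFDerivAt_equiv (h0 w₀ hw₀)).toOpenPartialHomeomorph T
  let e := e₀.restrOpen (Metric.ball w₀ r) Metric.isOpen_ball
  have he : ∀ w, e w = T w := fun w => rfl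
  have hsrc : w₀ ∈ e.source := by
    refine ⟨(hTs.hasStrictFDerivAt_equiv (h0 w₀ hw₀)).mem_toOpenPartialHomeomorph_source, hw₀r⟩
  have hes : ∀ w ∈ e.source, w ∈ Metric.ball w₀ r := fun w hw => hw.2
  let φ : IntegralCurve P Q :=
    { domain := e.target
      isOpen_domain := e.open_target
      toFun := fun t => ψ (e.symm t)
      hasDerivAt := by
        intro t ht
        have hs := e.map_target ht
        have hb := hes _ hs
        have h1 : HasDerivAt e.symm (h (e.symm t))⁻¹ t :=
          e.hasDerivAt_symm ht (h0 _ (hrS hb)) (hT _ hb)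
        have h2 := (hψ _ (hrS hb)).scomp t h1
        have h3 : (h (e.symm t))⁻¹ • h (e.symm t) • field P Q (ψ (e.symm t)) =
            field P Q (ψ (e.symm t)) := by
          rw [smul_smul, inv_mul_cancel₀ (h0 _ (hrS hb)), one_smul]
        rw [h3] at h2
        exact h2 }
  have hc := φ.continuous
  have h4 : ContinuousOn (fun w => toLeaf P Q (ψ w)) e.source := by
    rw [continuousOn_iff_continuous_domRestrict]
    have h5 : Continuous (fun w : e.source => (⟨e w, e.map_source w.2⟩ : e.target)) :=
      (continuousOn_iff_continuous_domRestrict.1 e.continuousOn).subtype_mk _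
    have h6 := hc.comp h5
    refine h6.congr ?_
    intro w
    change toLeaf P Q (ψ (e.symm (e w))) = toLeaf P Q (ψ w)
    rw [e.left_inv w.2]
  exact h4.continuousAt (e.open_source.mem_nhds hsrc)

/-! ### Homogeneous vector fields -/

/-- The determinant of two vectors of the plane. -/
def wedge (u v : ℂ × ℂ) : ℂ := u.1 * v.2 - u.2 * v.1

theorem eval_smul_of_isHomogeneous {P : Poly} {n : ℕ} (hP : P.IsHomogeneous n) (c a b : ℂ) :
    MvPolynomial.eval ![c * a, c * b] P = c ^ n * MvPolynomial.eval ![a, b] P := by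
  rw [MvPolynomial.eval_eq', MvPolynomial.eval_eq', Finset.mul_sum]
  refine Finset.sum_congr rfl fun m hm => ?_
  have h := hP (MvPolynomial.mem_support_iff.1 hm)
  have hd : m 0 + m 1 = n := by
    rw [← h, Finsupp.weight_apply, Finsupp.sum_fintype] <;> simp
  simp only [Fin.prod_univ_two, Matrix.cons_val_zero, Matrix.cons_val_one, mul_pow]
  rw [← hd, pow_add]
  ring

theorem field_smul {P Q : Poly} {n : ℕ} (hP : P.IsHomogeneous n) (hQ : Q.IsHomogeneous n)
    (c : ℂ) (p : ℂ × ℂ) : field P Q (c • p) = c ^ n • field P Q p := by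
  simp only [field, Prod.smul_fst, Prod.smul_snd, smul_eq_mul, eval_smul_of_isHomogeneous hP,
    eval_smul_of_isHomogeneous hQ, Prod.smul_mk]

theorem differentiable_eval (P : Poly) {u v : ℂ → ℂ} (hu : Differentiable ℂ u)
    (hv : Differentiable ℂ v) : Differentiable ℂ fun w => MvPolynomial.eval ![u w, v w] P := by
  induction P using MvPolynomial.induction_on with
  | C a => simp
  | add p q hp hq =>
    simp only [map_add]
    exact hp.add hq
  | mul_X p i hp =>
    fin_cases i
    · simpa only [map_mul, MvPolynomial.eval_X] using! hp.mul hu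
    · simpa only [map_mul, MvPolynomial.eval_X] using! hp.mul hv

/-- Local parametrization of the leaves of a homogeneous vector field by an affine line. -/
theorem continuousOn_exp_smul_line {P Q : Poly} {n : ℕ} (hP : P.IsHomogeneous n)
    (hQ : Q.IsHomogeneous n) {p v : ℂ × ℂ} (hpv : wedge p v ≠ 0) {S : Set ℂ} (hS : IsOpen S)
    {G : ℂ → ℂ}
    (hR : ∀ w ∈ S, wedge (field P Q (p + w • v)) (p + w • v) ≠ 0)
    (hG : ∀ w ∈ S, HasDerivAt G
      (-(wedge (field P Q (p + w • v)) v / wedge (field P Q (p + w • v)) (p + w • v))) w)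
    {C : ℂ} (hC : C ≠ 0) :
    ContinuousOn (fun w => toLeaf P Q ((C * Complex.exp (G w)) • (p + w • v))) S := by
  have hl : ∀ w, HasDerivAt (fun w : ℂ => p + w • v) v w := fun w => by
    simpa using ((hasDerivAt_id w).smul_const v).const_add p
  have hd1 : Differentiable ℂ fun w : ℂ => (p + w • v).1 := by
    simp only [Prod.fst_add, Prod.smul_fst]; fun_prop
  have hd2 : Differentiable ℂ fun w : ℂ => (p + w • v).2 := by
    simp only [Prod.snd_add, Prod.smul_snd]; fun_prop
  have hdR : Differentiable ℂ fun w => wedge (field P Q (p + w • v)) (p + w • v) :=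
    ((differentiable_eval P hd1 hd2).mul hd2).sub ((differentiable_eval Q hd1 hd2).mul hd1)
  -- With ℓ = p + w v, f the field at ℓ and λ = C exp G, the velocity is λ (G' ℓ + v). The identity
  -- f (ℓ∧v) + ℓ (v∧f) + v (f∧ℓ) = 0 turns this into -λ (p∧v)/(f∧ℓ) f, and the field at λ ℓ is λ^n
  -- f.
  refine continuousOn_leafSpace hS (h := fun w =>
    C * Complex.exp (G w) * (-(wedge p v) / wedge (field P Q (p + w • v)) (p + w • v)) /
      (C * Complex.exp (G w)) ^ n) ?_ ?_ ?_
  · intro w hw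
    have hGw := (hG w hw).differentiableAt
    have : C * Complex.exp (G w) ≠ 0 := mul_ne_zero hC (Complex.exp_ne_zero _)
    have hpow : (C * Complex.exp (G w)) ^ n ≠ 0 := pow_ne_zero _ this
    have hRw := hR w hw
    have hdRw := hdR w
    refine DifferentiableAt.differentiableWithinAt ?_
    exact DifferentiableAt.div (by fun_prop (disch := assumption)) (by fun_prop) hpow
  · intro w hw
    have : C * Complex.exp (G w) ≠ 0 := mul_ne_zero hC (Complex.exp_ne_zero _)
    exact div_ne_zero (mul_ne_zero this (div_ne_zero (neg_ne_zero.2 hpv) (hR w hw)))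
      (pow_ne_zero _ this)
  · intro w hw
    have hne : C * Complex.exp (G w) ≠ 0 := mul_ne_zero hC (Complex.exp_ne_zero _)
    have h1 := ((hG w hw).cexp.const_mul C).smul (hl w)
    refine h1.congr_deriv ?_
    rw [field_smul hP hQ, smul_smul, div_mul_cancel₀ _ (pow_ne_zero _ hne)]
    have hRw := hR w hw
    generalize field P Q (p + w • v) = f at hRw ⊢
    obtain ⟨D, hD⟩ : ∃ D, D = wedge f (p + w • v) := ⟨_, rfl⟩
    rw [← hD] at hRw ⊢
    simp only [wedge, Prod.fst_add, Prod.smul_fst, smul_eq_mul, Prod.snd_add,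
      Prod.smul_snd] at hD ⊢
    ext
    · simp only [Prod.fst_add, Prod.smul_fst, smul_eq_mul]
      field_simp
      rw [hD]
      ring
    · simp only [Prod.snd_add, Prod.smul_snd, smul_eq_mul]
      field_simp
      rw [hD]
      ring

/-- The points of an invariant line, except for the origin, belong to one leaf. -/
theorem smul_mem_leaf_of_wedge_eq_zero {P Q : Poly} {n : ℕ} (hP : P.IsHomogeneous n)
    (hQ : Q.IsHomogeneous n) {p : ℂ × ℂ} (hp : wedge (field P Q p) p = 0) (hp0 : p ≠ 0)
    (hf : field P Q p ≠ 0) {c : ℂ} (hc : c ≠ 0) : c • p ∈ leaf P Q p := by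
  obtain ⟨μ, hμ⟩ : ∃ μ : ℂ, field P Q p = μ • p := by
    simp only [wedge] at hp
    rcases eq_or_ne p.1 0 with h1 | h1
    · have h2 : p.2 ≠ 0 := fun h => hp0 (Prod.ext h1 h)
      refine ⟨(field P Q p).2 / p.2, Prod.ext ?_ ?_⟩
      · simp only [h1, mul_zero, sub_zero, mul_eq_zero, h2, or_false] at hp
        simp [h1, hp]
      · simp [h2]
    · refine ⟨(field P Q p).1 / p.1, Prod.ext ?_ ?_⟩
      · simp [h1]
      · simp only [Prod.smul_snd, smul_eq_mul]
        field_simp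
        linear_combination -hp
  have hμ0 : μ ≠ 0 := by rintro rfl; simp [hμ] at hf
  have hcont : ContinuousOn (fun w : ℂ => toLeaf P Q (Complex.exp w • p)) Set.univ := by
    refine continuousOn_leafSpace isOpen_univ
      (h := fun w => Complex.exp w / (Complex.exp w ^ n * μ)) ?_ ?_ ?_
    · intro w _
      have : Complex.exp w ^ n * μ ≠ 0 := mul_ne_zero (pow_ne_zero _ (Complex.exp_ne_zero _)) hμ0
      exact DifferentiableAt.differentiableWithinAt
        (DifferentiableAt.div (by fun_prop) (by fun_prop) this)
    · intro w _
      exact div_ne_zero (Complex.exp_ne_zero _)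
        (mul_ne_zero (pow_ne_zero _ (Complex.exp_ne_zero _)) hμ0)
    · intro w _
      refine ((Complex.hasDerivAt_exp w).smul_const p).congr_deriv ?_
      have : Complex.exp w ^ n * μ ≠ 0 := mul_ne_zero (pow_ne_zero _ (Complex.exp_ne_zero _)) hμ0
      rw [field_smul hP hQ, hμ, smul_smul (_ ^ n), smul_smul, div_mul_cancel₀ _ this]
  have h0 : Complex.exp 0 • p ∈ leaf P Q p := by
    rw [Complex.exp_zero, one_smul]
    exact mem_leaf_self P Q p
  have h1 := mem_leaf_of_image isPreconnected_univ hcont (Set.mem_univ 0) h0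
    (Set.mem_univ (Complex.log c))
  rwa [Complex.exp_log hc] at h1

/-! ### A figure eight in the complex line -/

/-- A parametrized figure eight: a closed curve of period `2π` that passes through `0` for the
multiples of `π` and encircles `1 / 2` and `-1 / 2`. -/
def eight (t : ℝ) : ℂ := Real.sin t * (1 + Complex.I * Real.cos t)

/-- The velocity of the figure eight. -/
def eightVel (t : ℝ) : ℂ :=
  Real.cos t * (1 + Complex.I * Real.cos t) - Complex.I * Real.sin t ^ 2

theorem hasDerivAt_eight (t : ℝ) : HasDerivAt eight (eightVel t) t := by
  have h1 : HasDerivAt (fun t : ℝ => (Real.sin t : ℂ)) (Real.cos t : ℂ) t :=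
    (Real.hasDerivAt_sin t).ofReal_comp
  have h2 : HasDerivAt (fun t : ℝ => (Real.cos t : ℂ)) ((-Real.sin t : ℝ) : ℂ) t :=
    (Real.hasDerivAt_cos t).ofReal_comp
  refine (h1.mul ((h2.const_mul Complex.I).const_add 1)).congr_deriv ?_
  simp only [eightVel, Complex.ofReal_neg]
  ring

theorem continuous_eight : Continuous eight := by unfold eight; fun_prop

theorem continuous_eightVel : Continuous eightVel := by unfold eightVel; fun_prop

theorem eight_re (t : ℝ) : (eight t).re = Real.sin t := by
  simp [eight, -Complex.ofReal_sin, -Complex.ofReal_cos]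

theorem eight_im (t : ℝ) : (eight t).im = Real.sin t * Real.cos t := by
  simp [eight, -Complex.ofReal_sin, -Complex.ofReal_cos]

theorem eight_neg (t : ℝ) : eight (-t) = -eight t := by simp [eight]

theorem eightVel_neg (t : ℝ) : eightVel (-t) = eightVel t := by simp [eightVel]

theorem eight_add_two_pi (t : ℝ) : eight (t + 2 * Real.pi) = eight t := by
  simp only [eight, Real.sin_add_two_pi, Real.cos_add_two_pi]

theorem eightVel_add_two_pi (t : ℝ) : eightVel (t + 2 * Real.pi) = eightVel t := by
  simp only [eightVel, Real.sin_add_two_pi, Real.cos_add_two_pi]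

/-- The figure eight has a single self-intersection. -/
theorem eight_eq_eight {s t : ℝ} (h : eight s = eight t) :
    (Real.sin s = 0 ∧ Real.sin t = 0) ∨ ∃ k : ℤ, s = t + k * (2 * Real.pi) := by
  have h1 : Real.sin s = Real.sin t := by rw [← eight_re, h, eight_re]
  have h2 : Real.sin s * Real.cos s = Real.sin t * Real.cos t := by rw [← eight_im, h, eight_im]
  rcases eq_or_ne (Real.sin t) 0 with h0 | h0
  · exact Or.inl ⟨h1.trans h0, h0⟩
  · right
    rw [h1] at h2
    have h3 := mul_left_cancel₀ h0 h2
    have h4 : (s : Real.Angle) = t := Real.Angle.cos_sin_inj h3 h1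
    obtain ⟨k, hk⟩ := Real.Angle.angle_eq_iff_two_pi_dvd_sub.1 h4
    exact ⟨k, by linear_combination hk⟩

/-- The factor `c` rotates the branch cut of the logarithm away from the arc and cancels in the
logarithmic derivative. -/
theorem integral_eightVel_div {ζ c : ℂ} {a b : ℝ} (hc : c ≠ 0)
    (h : ∀ t ∈ Set.uIcc a b, c * (eight t - ζ) ∈ Complex.slitPlane) :
    ∫ t in a..b, eightVel t / (eight t - ζ) =
      Complex.log (c * (eight b - ζ)) - Complex.log (c * (eight a - ζ)) := by
  have hne : ∀ t ∈ Set.uIcc a b, eight t - ζ ≠ 0 := fun t ht h0 => by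
    have := h t ht
    rw [h0, mul_zero] at this
    exact Complex.zero_notMem_slitPlane this
  refine intervalIntegral.integral_eq_sub_of_hasDerivAt
    (f := fun t => Complex.log (c * (eight t - ζ))) (fun t ht => ?_) ?_
  · have h1 : HasDerivAt (fun t => c * (eight t - ζ)) (c * eightVel t) t :=
      ((hasDerivAt_eight t).sub_const ζ).const_mul c
    refine (h1.clog_real (h t ht)).congr_deriv ?_
    rw [mul_div_mul_left _ _ hc]
  · exact (continuous_eightVel.continuousOn.div
      (continuous_eight.continuousOn.sub continuousOn_const) hne).intervalIntegrable

/-- The symmetry t ↦ -t exchanges the lobes, so statements about the left lobe reduce to the right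
one. -/
theorem integral_eightVel_div_neg (ζ : ℂ) :
    ∫ t in 0..(-Real.pi), eightVel t / (eight t - ζ) =
      ∫ t in 0..Real.pi, eightVel t / (eight t - -ζ) := by
  have h := intervalIntegral.integral_comp_neg (a := 0) (b := Real.pi)
    (fun t => eightVel t / (eight t - ζ))
  rw [neg_zero] at h
  rw [intervalIntegral.integral_symm, ← h, ← intervalIntegral.integral_neg]
  refine intervalIntegral.integral_congr fun t _ => ?_
  simp only [eight_neg, eightVel_neg]
  rw [← div_neg]
  congr 1
  ring

theorem eight_ne_half (t : ℝ) : eight t ≠ 1 / 2 := by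
  intro h0
  have h1 : Real.sin t = 1 / 2 := by
    have := congrArg Complex.re h0
    simpa [eight_re] using this
  have h2 : Real.sin t * Real.cos t = 0 := by
    have := congrArg Complex.im h0
    simpa [eight_im] using this
  have h3 := Real.sin_sq_add_cos_sq t
  rw [h1] at h2 h3
  have : Real.cos t = 0 := by linarith
  rw [this] at h3
  norm_num at h3

/-- The right loop of the figure eight winds around `1 / 2` once. -/
theorem integral_eightVel_half :
    ∫ t in 0..Real.pi, eightVel t / (eight t - 1 / 2) = -(2 * Real.pi * Complex.I) := by
  have hpi := Real.pi_pos
  -- The lobe is cut at its rightmost point. The upper arc avoids the ray going down from 1/2, the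
  -- lower arc the ray going up, so the cut is turned to these rays. The lobe runs clockwise, whence
  -- the sign.
  have hs1 : ∀ t ∈ Set.uIcc 0 (Real.pi / 2),
      -Complex.I * (eight t - 1 / 2) ∈ Complex.slitPlane := by
    intro t ht
    rw [Set.uIcc_of_le (by positivity)] at ht
    have h1 : 0 ≤ Real.sin t := Real.sin_nonneg_of_nonneg_of_le_pi ht.1 (by linarith [ht.2])
    have h2 : 0 ≤ Real.cos t := Real.cos_nonneg_of_mem_Icc ⟨by linarith [ht.1], ht.2⟩
    have h3 := Real.sin_sq_add_cos_sq t
    rw [Complex.mem_slitPlane_iff]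
    have hre : (-Complex.I * (eight t - 1 / 2)).re = Real.sin t * Real.cos t := by
      simp [eight_im]
    have him : (-Complex.I * (eight t - 1 / 2)).im = -(Real.sin t - 1 / 2) := by
      simp [eight_re]
    rw [hre, him]
    rcases (mul_nonneg h1 h2).lt_or_eq with h | h
    · exact Or.inl h
    · right
      intro h4
      have h5 : Real.sin t = 1 / 2 := by linarith
      rw [h5] at h h3
      have : Real.cos t = 0 := by linarith
      rw [this] at h3
      norm_num at h3
  have hs2 : ∀ t ∈ Set.uIcc (Real.pi / 2) Real.pi,
      Complex.I * (eight t - 1 / 2) ∈ Complex.slitPlane := by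
    intro t ht
    rw [Set.uIcc_of_le (by linarith)] at ht
    have h1 : 0 ≤ Real.sin t := Real.sin_nonneg_of_nonneg_of_le_pi (by linarith [ht.1]) ht.2
    have h2 : Real.cos t ≤ 0 := Real.cos_nonpos_of_pi_div_two_le_of_le ht.1 (by linarith [ht.2])
    have h3 := Real.sin_sq_add_cos_sq t
    rw [Complex.mem_slitPlane_iff]
    have hre : (Complex.I * (eight t - 1 / 2)).re = -(Real.sin t * Real.cos t) := by
      simp [eight_im]
    have him : (Complex.I * (eight t - 1 / 2)).im = Real.sin t - 1 / 2 := by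
      simp [eight_re]
    rw [hre, him]
    rcases (mul_nonpos_of_nonneg_of_nonpos h1 h2).lt_or_eq with h | h
    · exact Or.inl (by linarith)
    · right
      intro h4
      have h5 : Real.sin t = 1 / 2 := by linarith
      rw [h5] at h h3
      have : Real.cos t = 0 := by linarith
      rw [this] at h3
      norm_num at h3
  have hne : ∀ t, eight t - 1 / 2 ≠ 0 := fun t => sub_ne_zero.2 (eight_ne_half t)
  have hint : ∀ a b, IntervalIntegrable (fun t => eightVel t / (eight t - 1 / 2))
      MeasureTheory.volume a b := fun a b =>
    (continuous_eightVel.div (continuous_eight.sub continuous_const) hne).intervalIntegrable a b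
  rw [← intervalIntegral.integral_add_adjacent_intervals (hint 0 (Real.pi / 2)) (hint _ _),
    integral_eightVel_div (neg_ne_zero.2 Complex.I_ne_zero) hs1,
    integral_eightVel_div Complex.I_ne_zero hs2]
  have e0 : eight 0 = 0 := by simp [eight]
  have e1 : eight Real.pi = 0 := by simp [eight]
  have e2 : eight (Real.pi / 2) = 1 := by
    apply Complex.ext <;> simp [eight_re, eight_im]
  have l1 : Complex.log (Complex.I / 2) = Complex.log (1 / 2 : ℝ) + Real.pi / 2 * Complex.I := by
    rw [show Complex.I / 2 = ((1 / 2 : ℝ) : ℂ) * Complex.I by push_cast; ring,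
      Complex.log_ofReal_mul (by norm_num) Complex.I_ne_zero, Complex.log_I,
      Complex.ofReal_log (by norm_num)]
  have l2 : Complex.log (-Complex.I / 2) =
      Complex.log (1 / 2 : ℝ) - Real.pi / 2 * Complex.I := by
    rw [show -Complex.I / 2 = ((1 / 2 : ℝ) : ℂ) * (-Complex.I) by push_cast; ring,
      Complex.log_ofReal_mul (by norm_num) (neg_ne_zero.2 Complex.I_ne_zero), Complex.log_neg_I,
      Complex.ofReal_log (by norm_num)]
    ring
  rw [e0, e1, e2, show -Complex.I * (1 - 1 / 2) = -Complex.I / 2 by ring,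
    show -Complex.I * (0 - 1 / 2) = Complex.I / 2 by ring,
    show Complex.I * (1 - 1 / 2) = Complex.I / 2 by ring,
    show Complex.I * (0 - 1 / 2) = -Complex.I / 2 by ring, l1, l2]
  ring

/-- The right loop of the figure eight does not wind around a point with distance at least `1`
from its centre `1 / 2`. -/
theorem integral_eightVel_of_far {ζ : ℂ} (h : 1 ≤ ‖ζ - 1 / 2‖) :
    ∫ t in 0..Real.pi, eightVel t / (eight t - ζ) = 0 := by
  -- The lobe lies in the rectangle [0,1] × [-1/2,1/2], all of whose points are closer than 1 to the
  -- centre. So ζ is outside, a side of the rectangle separates it from the lobe, and `c` turns the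
  -- corresponding half plane into the right one.
  obtain ⟨c, hc⟩ : ∃ c : ℂ, ∀ t ∈ Set.uIcc 0 Real.pi, 0 < (c * (eight t - ζ)).re := by
    have h1 : 1 ≤ (ζ.re - 1 / 2) ^ 2 + ζ.im ^ 2 := by
      have := Complex.sq_norm (ζ - 1 / 2)
      rw [Complex.normSq_apply] at this
      simp only [Complex.sub_re, Complex.sub_im] at this
      norm_num at this
      nlinarith [norm_nonneg (ζ - 1 / 2)]
    have hs : ∀ t ∈ Set.uIcc 0 Real.pi, 0 ≤ Real.sin t := fun t ht => by
      rw [Set.uIcc_of_le Real.pi_pos.le] at ht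
      exact Real.sin_nonneg_of_mem_Icc ht
    have hsc : ∀ t, |Real.sin t * Real.cos t| ≤ 1 / 2 := fun t => by
      rw [abs_le]
      constructor <;> nlinarith [Real.sin_sq_add_cos_sq t, sq_nonneg (Real.sin t + Real.cos t),
        sq_nonneg (Real.sin t - Real.cos t)]
    by_cases hx1 : 1 < ζ.re
    · refine ⟨-1, fun t _ => ?_⟩
      simp only [neg_mul, one_mul, Complex.neg_re, Complex.sub_re, eight_re]
      linarith [Real.sin_le_one t]
    by_cases hx0 : ζ.re < 0
    · refine ⟨1, fun t ht => ?_⟩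
      simp only [one_mul, Complex.sub_re, eight_re]
      linarith [hs t ht]
    by_cases hy1 : 1 / 2 < ζ.im
    · refine ⟨Complex.I, fun t _ => ?_⟩
      simp only [Complex.I_mul_re, Complex.sub_im, eight_im]
      linarith [(abs_le.1 (hsc t)).2]
    by_cases hy0 : ζ.im < -(1 / 2)
    · refine ⟨-Complex.I, fun t _ => ?_⟩
      simp only [neg_mul, Complex.neg_re, Complex.I_mul_re, Complex.sub_im, eight_im]
      linarith [(abs_le.1 (hsc t)).1]
    exfalso
    push Not at hx1 hx0 hy1 hy0
    nlinarith
  have hc0 : c ≠ 0 := by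
    rintro rfl
    simpa using hc 0 Set.left_mem_uIcc
  rw [integral_eightVel_div hc0 fun t ht => Or.inl (hc t ht)]
  simp [eight]

/-- The figure eight avoids the points with distance at least `1` from its two centres. -/
theorem eight_ne_of_far {ζ : ℂ} (h1 : 1 ≤ ‖ζ - 1 / 2‖) (h2 : 1 ≤ ‖ζ + 1 / 2‖) (t : ℝ) :
    eight t ≠ ζ := by
  rintro rfl
  have e1 := Complex.sq_norm (eight t - 1 / 2)
  have e2 := Complex.sq_norm (eight t + 1 / 2)
  rw [Complex.normSq_apply] at e1 e2
  simp only [Complex.sub_re, Complex.sub_im, Complex.add_re, Complex.add_im, eight_re,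
    eight_im] at e1 e2
  norm_num at e1 e2
  have h3 := Real.sin_sq_add_cos_sq t
  have e1' : 1 ≤ ‖eight t - 1 / 2‖ ^ 2 := one_le_pow₀ h1
  have e2' : 1 ≤ ‖eight t + 1 / 2‖ ^ 2 := one_le_pow₀ h2
  rw [e1] at e1'
  rw [e2] at e2'
  have h4 : |Real.sin t| ≤ 1 := Real.abs_sin_le_one t
  have h5 : |Real.sin t| ^ 2 = Real.sin t ^ 2 := sq_abs _
  have h6 : 3 / 4 ≤ Real.sin t ^ 2 + Real.sin t ^ 2 * Real.cos t ^ 2 - |Real.sin t| := by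
    rcases abs_cases (Real.sin t) with ⟨h, _⟩ | ⟨h, _⟩ <;> rw [h] <;> nlinarith
  have h7 : Real.cos t ^ 2 = 1 - |Real.sin t| ^ 2 := by rw [h5]; linarith
  rw [h7, ← h5] at h6
  have h8 := abs_nonneg (Real.sin t)
  generalize |Real.sin t| = x at *
  nlinarith [mul_nonneg h8 (sub_nonneg.2 h4), sq_nonneg (x ^ 2 - 1/2), sq_nonneg (x-1)]

theorem eight_ne_neg_half (t : ℝ) : eight t ≠ -(1 / 2) := fun h =>
  eight_ne_half (-t) (by rw [eight_neg, h, neg_neg])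

/-! ### Periods along the figure eight -/

/-- The figure eight with the centre `z₀`, scaled by `d`. -/
def contour (z₀ d : ℂ) (t : ℝ) : ℂ := z₀ + d * eight t

theorem hasDerivAt_contour (z₀ d : ℂ) (t : ℝ) :
    HasDerivAt (contour z₀ d) (d * eightVel t) t :=
  ((hasDerivAt_eight t).const_mul d).const_add z₀

theorem continuous_contour (z₀ d : ℂ) : Continuous (contour z₀ d) :=
  continuous_const.add (continuous_const.mul continuous_eight)

theorem contour_add_two_pi (z₀ d : ℂ) (t : ℝ) :
    contour z₀ d (t + 2 * Real.pi) = contour z₀ d t := by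
  rw [contour, contour, eight_add_two_pi]

/-- The integral of `g(z) dz` along the figure eight from the parameter `0` to `t`. -/
def period (g : ℂ → ℂ) (z₀ d : ℂ) (t : ℝ) : ℂ :=
  ∫ τ in 0..t, g (contour z₀ d τ) * (d * eightVel τ)

theorem period_zero (g : ℂ → ℂ) (z₀ d : ℂ) : period g z₀ d 0 = 0 :=
  intervalIntegral.integral_same

section period

variable {g : ℂ → ℂ} {z₀ d : ℂ}

theorem continuous_period_integrand (hg : Continuous fun t => g (contour z₀ d t)) :
    Continuous fun t => g (contour z₀ d t) * (d * eightVel t) :=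
  hg.mul (continuous_const.mul continuous_eightVel)

theorem hasDerivAt_period (hg : Continuous fun t => g (contour z₀ d t)) (t : ℝ) :
    HasDerivAt (period g z₀ d) (g (contour z₀ d t) * (d * eightVel t)) t :=
  (continuous_period_integrand hg).integral_hasStrictDerivAt 0 t |>.hasDerivAt

/-- A full turn adds a fixed amount. The left period enters with a minus sign because it is counted
from 0 to -π. -/
theorem period_add_two_pi (hg : Continuous fun t => g (contour z₀ d t)) (t : ℝ) :
    period g z₀ d (t + 2 * Real.pi) =
      period g z₀ d t + (period g z₀ d Real.pi - period g z₀ d (-Real.pi)) := by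
  have hc := continuous_period_integrand hg
  have hp : Function.Periodic (fun t => g (contour z₀ d t) * (d * eightVel t)) (2 * Real.pi) :=
    fun t => by simp only [contour_add_two_pi, eightVel_add_two_pi]
  have h1 := hp.intervalIntegral_add_eq t (-Real.pi)
  rw [show -Real.pi + 2 * Real.pi = Real.pi by ring] at h1
  simp only [period]
  rw [← intervalIntegral.integral_add_adjacent_intervals (hc.intervalIntegrable 0 t)
    (hc.intervalIntegrable _ _), h1,
    intervalIntegral.integral_interval_sub_left (hc.intervalIntegrable _ _)
    (hc.intervalIntegrable _ _)]

end period

/-! ### Lifting the figure eight to the leaves -/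

/-- The denominator of the logarithmic derivative of `y` along the leaves, in the affine coordinate
`z = x / y`. -/
def den (P Q : Poly) (z : ℂ) : ℂ :=
  MvPolynomial.eval ![z, 1] P - z * MvPolynomial.eval ![z, 1] Q

/-- The logarithmic derivative of `y` along the leaves, in the affine coordinate `z = x / y`. -/
def slope (P Q : Poly) (z : ℂ) : ℂ := MvPolynomial.eval ![z, 1] Q / den P Q z

/-- The figure eight avoids the invariant lines, and its periods satisfy no linear relation with
small coefficients. -/
structure IsGoodContour (P Q : Poly) (z₀ d : ℂ) : Prop where
  den_ne_zero : ∀ t, den P Q (contour z₀ d t) ≠ 0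
  right_ne_zero : (period (slope P Q) z₀ d Real.pi).re ≠ 0
  left_ne_zero : (period (slope P Q) z₀ d (-Real.pi)).re ≠ 0
  add_ne_zero : (period (slope P Q) z₀ d Real.pi).re +
    (period (slope P Q) z₀ d (-Real.pi)).re ≠ 0
  two_right_ne_zero : 2 * (period (slope P Q) z₀ d Real.pi).re +
    (period (slope P Q) z₀ d (-Real.pi)).re ≠ 0
  two_left_ne_zero : (period (slope P Q) z₀ d Real.pi).re +
    2 * (period (slope P Q) z₀ d (-Real.pi)).re ≠ 0

theorem differentiable_den (P Q : Poly) : Differentiable ℂ (den P Q) :=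
  (differentiable_eval P differentiable_id (differentiable_const 1)).sub
    (differentiable_id.mul (differentiable_eval Q differentiable_id (differentiable_const 1)))

theorem differentiableAt_slope {P Q : Poly} {z : ℂ} (hz : den P Q z ≠ 0) :
    DifferentiableAt ℂ (slope P Q) z :=
  (differentiable_eval Q differentiable_id (differentiable_const 1) z).div
    (differentiable_den P Q z) hz

/-- The leaves of a homogeneous vector field near a point of the line `y = 1`. -/
theorem continuousOn_exp_smul_chart {P Q : Poly} {n : ℕ} (hP : P.IsHomogeneous n)
    (hQ : Q.IsHomogeneous n) {S : Set ℂ} (hS : IsOpen S) {G : ℂ → ℂ}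
    (hR : ∀ w ∈ S, den P Q w ≠ 0) (hG : ∀ w ∈ S, HasDerivAt G (slope P Q w) w)
    {C : ℂ} (hC : C ≠ 0) :
    ContinuousOn (fun w : ℂ => toLeaf P Q ((C * Complex.exp (G w)) • (w, (1 : ℂ)))) S := by
  have hl : ∀ w : ℂ, ((0, 1) : ℂ × ℂ) + w • (1, 0) = (w, 1) := fun w => by simp
  have hd : ∀ w : ℂ, wedge (field P Q (w, 1)) (w, 1) = den P Q w := fun w => by
    simp [wedge, field, den, mul_comm]
  have h := continuousOn_exp_smul_line hP hQ (p := (0, 1)) (v := (1, 0)) (by simp [wedge]) hS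
    (G := G) (fun w hw => by rw [hl, hd]; exact hR w hw)
    (fun w hw => by
      rw [hl, hd]
      convert hG w hw using 1
      simp [wedge, field, slope, neg_div]) hC
  simpa only [hl] using h

/-- A lift of the figure eight to a leaf. -/
def lift (P Q : Poly) (z₀ d C : ℂ) (t : ℝ) : ℂ × ℂ :=
  (C * Complex.exp (period (slope P Q) z₀ d t)) • (contour z₀ d t, 1)

/-- A closed loop consisting of two lifts of the figure eight. -/
def doubleLift (P Q : Poly) (z₀ d C : ℂ) (s : ℝ) : ℂ × ℂ :=
  -- With a and b the right and left periods, the factors at s = 0, 1/4, 1/2, 3/4 are C e^b, C, C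
  -- e^a, C e^(a+b), and s → 1 leads back to C e^b. The second half runs through the eight
  -- backwards, from 0 to -2π.
  if Int.fract s ≤ 1 / 2 then lift P Q z₀ d C (4 * Real.pi * Int.fract s - Real.pi)
  else lift P Q z₀ d (C * Complex.exp (period (slope P Q) z₀ d Real.pi))
    (2 * Real.pi - 4 * Real.pi * Int.fract s)

section lift

variable {P Q : Poly} {z₀ d : ℂ}

theorem continuous_slope_contour (hden : ∀ t, den P Q (contour z₀ d t) ≠ 0) :
    Continuous fun t => slope P Q (contour z₀ d t) :=
  continuous_iff_continuousAt.2 fun t =>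
    (differentiableAt_slope (hden t)).continuousAt.comp (continuous_contour z₀ d).continuousAt

/-- Near any parameter the period differs by a constant from a local primitive of `slope` evaluated
on the contour, so the lift is the contour composed with a leaf chart. -/
theorem continuous_lift {n : ℕ} (hP : P.IsHomogeneous n) (hQ : Q.IsHomogeneous n)
    (hden : ∀ t, den P Q (contour z₀ d t) ≠ 0) {C : ℂ} (hC : C ≠ 0) :
    Continuous fun t => toLeaf P Q (lift P Q z₀ d C t) := by
  refine continuous_iff_continuousAt.2 fun t₀ => ?_
  have hopen : IsOpen {z | den P Q z ≠ 0} :=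
    isOpen_ne_fun (differentiable_den P Q).continuous continuous_const
  obtain ⟨r, hr, hrS⟩ := Metric.isOpen_iff.1 hopen _ (hden t₀)
  have hd : DifferentiableOn ℂ (slope P Q) (Metric.ball (contour z₀ d t₀) r) := fun z hz =>
    (differentiableAt_slope (hrS hz)).differentiableWithinAt
  obtain ⟨G, hG⟩ := hd.isExactOn_ball
  have hpre : IsOpen (contour z₀ d ⁻¹' Metric.ball (contour z₀ d t₀) r) :=
    Metric.isOpen_ball.preimage (continuous_contour z₀ d)
  obtain ⟨ε, hε, hεS⟩ := Metric.isOpen_iff.1 hpre t₀ (Metric.mem_ball_self hr)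
  have hder : ∀ t ∈ Metric.ball t₀ ε,
      HasDerivAt (fun t => period (slope P Q) z₀ d t - G (contour z₀ d t)) 0 t := fun t ht => by
    have h1 := hasDerivAt_period (continuous_slope_contour hden) t
    have h2 := (hG _ (hεS ht)).comp_of_eq t (hasDerivAt_contour z₀ d t) rfl
    exact (h1.sub h2).congr_deriv (by simp)
  have hconst : ∀ t ∈ Metric.ball t₀ ε, period (slope P Q) z₀ d t =
      (period (slope P Q) z₀ d t₀ - G (contour z₀ d t₀)) + G (contour z₀ d t) := fun t ht => by
    have := Metric.isOpen_ball.is_const_of_deriv_eq_zero (convex_ball t₀ ε).isPreconnected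
      (fun t ht => (hder t ht).differentiableAt.differentiableWithinAt)
      (fun t ht => (hder t ht).deriv) ht (Metric.mem_ball_self hε)
    linear_combination this
  have hK : C * Complex.exp (period (slope P Q) z₀ d t₀ - G (contour z₀ d t₀)) ≠ 0 :=
    mul_ne_zero hC (Complex.exp_ne_zero _)
  have hcont := (continuousOn_exp_smul_chart hP hQ Metric.isOpen_ball
    (fun w hw => hrS hw) hG hK).comp (continuous_contour z₀ d).continuousOn hεS
  refine (hcont.continuousAt (Metric.ball_mem_nhds t₀ hε)).congr ?_
  filter_upwards [Metric.ball_mem_nhds t₀ hε] with t ht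
  simp only [Function.comp_apply, lift]
  rw [hconst t ht, Complex.exp_add, mul_assoc]

theorem lift_zero (C : ℂ) : lift P Q z₀ d C 0 = C • (z₀, 1) := by
  simp [lift, period_zero, contour, eight]

theorem lift_pi (C : ℂ) : lift P Q z₀ d C Real.pi =
    (C * Complex.exp (period (slope P Q) z₀ d Real.pi)) • (z₀, 1) := by
  simp [lift, contour, eight]

theorem lift_neg_pi (C : ℂ) : lift P Q z₀ d C (-Real.pi) =
    (C * Complex.exp (period (slope P Q) z₀ d (-Real.pi))) • (z₀, 1) := by
  simp [lift, contour, eight]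

/-- This closes the double lift: the period at -2π is the left one minus the right one, and the
right one cancels against the factor in front. -/
theorem lift_neg_two_pi (hden : ∀ t, den P Q (contour z₀ d t) ≠ 0) (C : ℂ) :
    lift P Q z₀ d (C * Complex.exp (period (slope P Q) z₀ d Real.pi)) (-(2 * Real.pi)) =
      (C * Complex.exp (period (slope P Q) z₀ d (-Real.pi))) • (z₀, 1) := by
  have h := period_add_two_pi (continuous_slope_contour hden) (-(2 * Real.pi))
  rw [neg_add_cancel, period_zero] at h
  have h1 : period (slope P Q) z₀ d (-(2 * Real.pi)) = period (slope P Q) z₀ d (-Real.pi) -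
    period (slope P Q) z₀ d Real.pi := by linear_combination -h
  rw [lift, h1, mul_assoc, ← Complex.exp_add, add_sub_cancel]
  simp [contour, eight]

theorem periodic_doubleLift (C : ℂ) : Function.Periodic (doubleLift P Q z₀ d C) 1 := fun s => by
  simp only [doubleLift, Int.fract_add_one]

theorem continuous_doubleLift {n : ℕ} (hP : P.IsHomogeneous n) (hQ : Q.IsHomogeneous n)
    (hden : ∀ t, den P Q (contour z₀ d t) ≠ 0) {C : ℂ} (hC : C ≠ 0) :
    Continuous fun s => toLeaf P Q (doubleLift P Q z₀ d C s) := by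
  have hC' : C * Complex.exp (period (slope P Q) z₀ d Real.pi) ≠ 0 :=
    mul_ne_zero hC (Complex.exp_ne_zero _)
  have h1 : Continuous fun f : ℝ => toLeaf P Q (lift P Q z₀ d C (4 * Real.pi * f - Real.pi)) :=
    (continuous_lift hP hQ hden hC).comp (by fun_prop)
  have h2 : Continuous fun f : ℝ => toLeaf P Q
      (lift P Q z₀ d (C * Complex.exp (period (slope P Q) z₀ d Real.pi))
        (2 * Real.pi - 4 * Real.pi * f)) :=
    (continuous_lift hP hQ hden hC').comp (by fun_prop)
  have h3 : Continuous fun f : ℝ => if f ≤ 1 / 2 then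
      toLeaf P Q (lift P Q z₀ d C (4 * Real.pi * f - Real.pi)) else
      toLeaf P Q (lift P Q z₀ d (C * Complex.exp (period (slope P Q) z₀ d Real.pi))
        (2 * Real.pi - 4 * Real.pi * f)) := by
    refine Continuous.if_le h1 h2 continuous_id continuous_const fun f hf => ?_
    rw [show f = 1 / 2 from hf, show 4 * Real.pi * (1 / 2) - Real.pi = Real.pi by ring,
      show 2 * Real.pi - 4 * Real.pi * (1 / 2) = 0 by ring, lift_pi, lift_zero]
  have h4 := h3.continuousOn (s := Set.Icc 0 1) |>.comp_fract'' (by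
    rw [if_pos (by norm_num), if_neg (by norm_num),
      show 4 * Real.pi * 0 - Real.pi = -Real.pi by ring,
      show 2 * Real.pi - 4 * Real.pi * 1 = -(2 * Real.pi) by ring, lift_neg_pi,
      lift_neg_two_pi hden])
  refine h4.congr fun s => ?_
  simp only [doubleLift, Function.comp_apply]
  split_ifs <;> rfl

theorem doubleLift_quarter (C : ℂ) : doubleLift P Q z₀ d C (1 / 4) = C • (z₀, 1) := by
  have : Int.fract (1 / 4 : ℝ) = 1 / 4 := Int.fract_eq_self.2 (by norm_num)
  rw [doubleLift, this, if_pos (by norm_num),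
    show 4 * Real.pi * (1 / 4) - Real.pi = 0 by ring, lift_zero]

theorem doubleLift_three_quarters (C : ℂ) : doubleLift P Q z₀ d C (3 / 4) =
    (C * Complex.exp (period (slope P Q) z₀ d Real.pi + period (slope P Q) z₀ d (-Real.pi))) •
      (z₀, 1) := by
  have : Int.fract (3 / 4 : ℝ) = 3 / 4 := Int.fract_eq_self.2 (by norm_num)
  rw [doubleLift, this, if_neg (by norm_num),
    show 2 * Real.pi - 4 * Real.pi * (3 / 4) = -Real.pi by ring, lift_neg_pi, mul_assoc,
    ← Complex.exp_add]

end lift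

/-! ### The handles -/

section handles

variable {P Q : Poly} {z₀ d : ℂ}

theorem IsGoodContour.scale_ne_zero (h : IsGoodContour P Q z₀ d) : d ≠ 0 := by
  rintro rfl
  exact h.right_ne_zero (by simp [period])

/-- The logarithm of the absolute value of `y` along the lift of the figure eight. -/
def height (P Q : Poly) (z₀ d : ℂ) (t : ℝ) : ℝ := (period (slope P Q) z₀ d t).re

theorem height_add_two_pi (hden : ∀ t, den P Q (contour z₀ d t) ≠ 0) (t : ℝ) :
    height P Q z₀ d (t + 2 * Real.pi) =
      height P Q z₀ d t + (height P Q z₀ d Real.pi - height P Q z₀ d (-Real.pi)) := by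
  simp only [height, period_add_two_pi (continuous_slope_contour hden), Complex.add_re,
    Complex.sub_re]

theorem log_norm_lift_snd {C : ℂ} (hC : C ≠ 0) (t : ℝ) :
    Real.log ‖(lift P Q z₀ d C t).2‖ = Real.log ‖C‖ + height P Q z₀ d t := by
  simp only [lift, Prod.smul_snd, smul_eq_mul, mul_one, norm_mul, Complex.norm_exp]
  rw [Real.log_mul (norm_ne_zero_iff.2 hC) (Real.exp_ne_zero _), Real.log_exp, height]

/-- The quotient of the two coordinates recovers the point of the contour. -/
theorem eight_eq_of_lift_eq (hd : d ≠ 0) {C C' : ℂ} (hC : C ≠ 0) {s t : ℝ}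
    (h : lift P Q z₀ d C s = lift P Q z₀ d C' t) : eight s = eight t := by
  have h2 := congrArg Prod.snd h
  have h1 := congrArg Prod.fst h
  simp only [lift, Prod.smul_fst, Prod.smul_snd, smul_eq_mul, mul_one] at h1 h2
  rw [← h2] at h1
  have h3 := mul_left_cancel₀ (mul_ne_zero hC (Complex.exp_ne_zero _)) h1
  exact mul_left_cancel₀ hd (add_left_cancel h3)

/-- A point of a double lift lies on one of its two halves. -/
theorem doubleLift_cases (P Q : Poly) (z₀ d C : ℂ) (s : ℝ) :
    (∃ t ∈ Set.Icc (-Real.pi) Real.pi, t = 4 * Real.pi * Int.fract s - Real.pi ∧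
      doubleLift P Q z₀ d C s = lift P Q z₀ d C t) ∨
    (∃ t ∈ Set.Ioo (-(2 * Real.pi)) 0, t = 2 * Real.pi - 4 * Real.pi * Int.fract s ∧
      doubleLift P Q z₀ d C s =
        lift P Q z₀ d (C * Complex.exp (period (slope P Q) z₀ d Real.pi)) t) := by
  have hpi := Real.pi_pos
  have h0 := Int.fract_nonneg s
  have h1 := Int.fract_lt_one s
  by_cases h : Int.fract s ≤ 1 / 2
  · refine Or.inl ⟨_, ⟨?_, ?_⟩, rfl, by rw [doubleLift, if_pos h]⟩ <;> nlinarith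
  · push Not at h
    refine Or.inr ⟨_, ⟨?_, ?_⟩, rfl, by rw [doubleLift, if_neg h.not_ge]⟩ <;> nlinarith

theorem eq_of_sin_eq_zero {t : ℝ} (ht : Real.sin t = 0) (h : t ∈ Set.Icc (-Real.pi) Real.pi) :
    t = -Real.pi ∨ t = 0 ∨ t = Real.pi := by
  obtain ⟨n, rfl⟩ := Real.sin_eq_zero_iff.1 ht
  have hpi := Real.pi_pos
  have h1 : (n : ℝ) ≤ 1 := by nlinarith [h.2]
  have h2 : (-1 : ℝ) ≤ n := by nlinarith [h.1]
  have h1' : n ≤ 1 := by exact_mod_cast h1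
  have h2' : -1 ≤ n := by exact_mod_cast h2
  interval_cases n <;> simp

theorem eq_of_sin_eq_zero' {t : ℝ} (ht : Real.sin t = 0) (h : t ∈ Set.Ioo (-(2 * Real.pi)) 0) :
    t = -Real.pi := by
  obtain ⟨n, rfl⟩ := Real.sin_eq_zero_iff.1 ht
  have hpi := Real.pi_pos
  have h1 : (n : ℝ) < 0 := by nlinarith [h.2]
  have h2 : (-2 : ℝ) < n := by nlinarith [h.1]
  have h1' : n < 0 := by exact_mod_cast h1
  have h2' : -2 < n := by exact_mod_cast h2
  interval_cases n; simp

theorem height_add_int_mul (hden : ∀ t, den P Q (contour z₀ d t) ≠ 0) (t : ℝ) (k : ℤ) :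
    height P Q z₀ d (t + k * (2 * Real.pi)) =
      height P Q z₀ d t + k * (height P Q z₀ d Real.pi - height P Q z₀ d (-Real.pi)) := by
  induction k with
  | zero => simp
  | succ k ih =>
    have := height_add_two_pi hden (t + (k : ℤ) * (2 * Real.pi))
    push_cast at this ih ⊢
    rw [show t + (k + 1) * (2 * Real.pi) = t + k * (2 * Real.pi) + 2 * Real.pi by ring, this, ih]
    ring
  | pred k ih =>
    have := height_add_two_pi hden (t + ((-k - 1 : ℤ) : ℝ) * (2 * Real.pi))
    push_cast at this ih ⊢
    rw [show t + (-k - 1) * (2 * Real.pi) + 2 * Real.pi = t + -k * (2 * Real.pi) by ring, ih]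
      at this
    linarith

/-- The factor between the two loops of a handle. -/
def handleFactor (P Q : Poly) (z₀ d : ℂ) : ℂ :=
  Complex.exp (-(period (slope P Q) z₀ d Real.pi + period (slope P Q) z₀ d (-Real.pi)))

/-- Coinciding points have the same projection to the eight and the same log |y|. Let A and B be the
heights at π and -π. Over the crossing, the heights relative to log ‖C‖ are B, 0, A, A + B on the
first loop and these minus A + B on the second. Elsewhere the parameters differ by a multiple of 2π.
Every coincidence except 0 = 0 makes one of A, B, A + B, 2A + B, A + 2B vanish. -/
theorem doubleLift_eq_doubleLift (h : IsGoodContour P Q z₀ d) {C : ℂ} (hC : C ≠ 0) {s t : ℝ}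
    (hst : doubleLift P Q z₀ d C s = doubleLift P Q z₀ d (C * handleFactor P Q z₀ d) t) :
    Int.fract s = 1 / 4 ∧ Int.fract t = 3 / 4 := by
  have hpi := Real.pi_pos
  have hd := h.scale_ne_zero
  have hk : handleFactor P Q z₀ d ≠ 0 := Complex.exp_ne_zero _
  have he := Complex.exp_ne_zero (period (slope P Q) z₀ d Real.pi)
  have hCk := mul_ne_zero hC hk
  have hlog : Real.log ‖(doubleLift P Q z₀ d C s).2‖ =
      Real.log ‖(doubleLift P Q z₀ d (C * handleFactor P Q z₀ d) t).2‖ := by rw [hst]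
  have lk : Real.log ‖C * handleFactor P Q z₀ d‖ = Real.log ‖C‖ -
      (height P Q z₀ d Real.pi + height P Q z₀ d (-Real.pi)) := by
    rw [norm_mul, Real.log_mul (norm_ne_zero_iff.2 hC) (norm_ne_zero_iff.2 hk), handleFactor,
      Complex.norm_exp, Real.log_exp]
    simp only [height, Complex.neg_re, Complex.add_re]
    ring
  have le : ∀ D : ℂ, D ≠ 0 → Real.log ‖D * Complex.exp (period (slope P Q) z₀ d Real.pi)‖ =
      Real.log ‖D‖ + height P Q z₀ d Real.pi := fun D hD => by
    rw [norm_mul, Real.log_mul (norm_ne_zero_iff.2 hD) (norm_ne_zero_iff.2 he),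
      Complex.norm_exp, Real.log_exp, height]
  have hA : height P Q z₀ d Real.pi ≠ 0 := h.right_ne_zero
  have hB : height P Q z₀ d (-Real.pi) ≠ 0 := h.left_ne_zero
  have hAB : height P Q z₀ d Real.pi + height P Q z₀ d (-Real.pi) ≠ 0 := h.add_ne_zero
  have hAAB : 2 * height P Q z₀ d Real.pi + height P Q z₀ d (-Real.pi) ≠ 0 := h.two_right_ne_zero
  have hABB : height P Q z₀ d Real.pi + 2 * height P Q z₀ d (-Real.pi) ≠ 0 := h.two_left_ne_zero
  have h0 : height P Q z₀ d 0 = 0 := by simp [height, period_zero]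
  have hadd := height_add_int_mul h.den_ne_zero
  rcases doubleLift_cases P Q z₀ d C s with ⟨s', hs', hss, hs⟩ | ⟨s', hs', hss, hs⟩ <;>
  rcases doubleLift_cases P Q z₀ d (C * handleFactor P Q z₀ d) t with
    ⟨t', ht', htt, ht⟩ | ⟨t', ht', htt, ht⟩ <;>
  rw [hs, ht] at hst <;>
  rw [hs, ht, log_norm_lift_snd (by simp [hC]), log_norm_lift_snd (by simp [hC, hk])] at hlog <;>
  rcases eight_eq_eight (eight_eq_of_lift_eq hd (by simp [hC]) hst) with ⟨e1, e2⟩ | ⟨k, hk'⟩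
  · exfalso
    rw [lk] at hlog
    rcases eq_of_sin_eq_zero e1 hs' with rfl | rfl | rfl <;>
    rcases eq_of_sin_eq_zero e2 ht' with rfl | rfl | rfl <;>
    first
    | exact hA (by linarith)
    | exact hB (by linarith)
    | exact hAB (by linarith)
    | exact hAAB (by linarith)
    | exact hABB (by linarith)
  · exfalso
    rw [lk, hk', hadd] at hlog
    have hk1 : (k : ℝ) < 2 := by nlinarith [hs'.2, ht'.1]
    have hk2 : (-2 : ℝ) < k := by nlinarith [hs'.1, ht'.2]
    have hk1' : k < 2 := by exact_mod_cast hk1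
    have hk2' : -2 < k := by exact_mod_cast hk2
    interval_cases k <;> push_cast at hlog <;>
    first
    | exact hA (by linarith)
    | exact hB (by linarith)
    | exact hAB (by linarith)
  -- The one surviving case: first half of the first loop, second half of the second, both at the
  -- crossing.
  · rw [le _ hCk, lk] at hlog
    rw [eq_of_sin_eq_zero' e2 ht'] at hlog htt
    rcases eq_of_sin_eq_zero e1 hs' with rfl | rfl | rfl
    · exact absurd (by linarith) hB
    · constructor <;> nlinarith
    · exact absurd (by linarith) hA
  · exfalso
    rw [le _ hCk, lk, hk', hadd] at hlog
    have hk1 : (k : ℝ) < 2 := by nlinarith [hs'.2, ht'.1]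
    have hk2 : (-1 : ℝ) < k := by nlinarith [hs'.1, ht'.2]
    have hk1' : k < 2 := by exact_mod_cast hk1
    have hk2' : -1 < k := by exact_mod_cast hk2
    interval_cases k <;> push_cast at hlog <;>
    first
    | exact hA (by linarith)
    | exact hB (by linarith)
  · exfalso
    rw [le _ hC, lk] at hlog
    rw [eq_of_sin_eq_zero' e1 hs'] at hlog
    rcases eq_of_sin_eq_zero e2 ht' with rfl | rfl | rfl <;>
    first
    | exact hAB (by linarith)
    | exact hAAB (by linarith)
    | exact hABB (by linarith)
  · exfalso
    rw [le _ hC, lk, hk', hadd] at hlog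
    have hk1 : (k : ℝ) < 1 := by nlinarith [hs'.2, ht'.1]
    have hk2 : (-2 : ℝ) < k := by nlinarith [hs'.1, ht'.2]
    have hk1' : k < 1 := by exact_mod_cast hk1
    have hk2' : -2 < k := by exact_mod_cast hk2
    interval_cases k <;> push_cast at hlog <;>
    first
    | exact hAAB (by linarith)
    | exact hABB (by linarith)
  · exfalso
    rw [le _ hC, le _ hCk, lk, eq_of_sin_eq_zero' e1 hs', eq_of_sin_eq_zero' e2 ht'] at hlog
    exact hAB (by linarith)
  · exfalso
    rw [le _ hC, le _ hCk, lk, hk', hadd] at hlog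
    have hk1 : (k : ℝ) < 1 := by nlinarith [hs'.2, ht'.1]
    have hk2 : (-1 : ℝ) < k := by nlinarith [hs'.1, ht'.2]
    have hk1' : k < 1 := by exact_mod_cast hk1
    have hk2' : -1 < k := by exact_mod_cast hk2
    interval_cases k
    push_cast at hlog
    exact hAB (by linarith)

end handles

/-! ### Transversality and infinitely many disjoint handles -/

section genus

variable {P Q : Poly} {z₀ d : ℂ}

theorem hasDerivAt_lift (hden : ∀ t, den P Q (contour z₀ d t) ≠ 0) (C : ℂ) (t : ℝ) :
    HasDerivAt (lift P Q z₀ d C)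
      ((C * Complex.exp (period (slope P Q) z₀ d t) * (d * eightVel t)) •
        (slope P Q (contour z₀ d t) * contour z₀ d t + 1, slope P Q (contour z₀ d t))) t := by
  have h1 := ((hasDerivAt_period (continuous_slope_contour hden) t).cexp.const_mul C).smul
    ((hasDerivAt_contour z₀ d t).prodMk (hasDerivAt_const t (1 : ℂ)))
  refine h1.congr_deriv ?_
  ext
  · simp only [Prod.fst_add, Prod.smul_fst, smul_eq_mul]
    ring
  · simp only [Prod.snd_add, Prod.smul_snd, smul_eq_mul]
    ring

theorem contDiff_lift (hden : ∀ t, den P Q (contour z₀ d t) ≠ 0) (C : ℂ) :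
    ContDiff ℝ 1 (lift P Q z₀ d C) := by
  rw [contDiff_one_iff_deriv]
  refine ⟨fun t => (hasDerivAt_lift hden C t).differentiableAt, ?_⟩
  rw [funext fun t => (hasDerivAt_lift hden C t).deriv]
  have h1 : Continuous (period (slope P Q) z₀ d) := continuous_iff_continuousAt.2 fun t =>
    (hasDerivAt_period (continuous_slope_contour hden) t).continuousAt
  have h2 := continuous_slope_contour hden
  have h3 := continuous_contour z₀ d
  have h4 := continuous_eightVel
  fun_prop

/-- At the meeting point both velocities are complex multiples of one nonzero vector tangent to the
leaf. The multipliers are those of the two branches of the eight, 1 + i and -1 + i up to a common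
complex and real factors, and these are independent over the reals. -/
theorem meetTransversallyOnce_doubleLift (h : IsGoodContour P Q z₀ d) {C : ℂ} (hC : C ≠ 0) :
    MeetTransversallyOnce (doubleLift P Q z₀ d C)
      (doubleLift P Q z₀ d (C * handleFactor P Q z₀ d)) := by
  have hpi := Real.pi_pos
  have hd := h.scale_ne_zero
  have e0 : eightVel 0 = 1 + Complex.I := by simp [eightVel]
  have e1 : eightVel (-Real.pi) = -1 + Complex.I := by simp [eightVel]; ring
  have c0 : contour z₀ d 0 = z₀ := by simp [contour, eight]
  have c1 : contour z₀ d (-Real.pi) = z₀ := by simp [contour, eight]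
  have hfac : C * handleFactor P Q z₀ d * Complex.exp (period (slope P Q) z₀ d Real.pi) *
      Complex.exp (period (slope P Q) z₀ d (-Real.pi)) = C := by
    rw [handleFactor, mul_assoc, mul_assoc, ← Complex.exp_add, ← Complex.exp_add]
    simp
  -- The junctions of the halves are at 0 and 1/2, so near 1/4 and 3/4 each loop is a single smooth
  -- lift.
  have ha : doubleLift P Q z₀ d C =ᶠ[𝓝 (1 / 4)]
      fun s => lift P Q z₀ d C (4 * Real.pi * s - Real.pi) := by
    filter_upwards [Ioo_mem_nhds (show (0 : ℝ) < 1 / 4 by norm_num)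
      (show (1 / 4 : ℝ) < 1 / 2 by norm_num)] with s hs
    have : Int.fract s = s := Int.fract_eq_self.2 ⟨hs.1.le, by linarith [hs.2]⟩
    rw [doubleLift, this, if_pos hs.2.le]
  have hb : doubleLift P Q z₀ d (C * handleFactor P Q z₀ d) =ᶠ[𝓝 (3 / 4)]
      fun s => lift P Q z₀ d (C * handleFactor P Q z₀ d *
        Complex.exp (period (slope P Q) z₀ d Real.pi)) (2 * Real.pi - 4 * Real.pi * s) := by
    filter_upwards [Ioo_mem_nhds (show (1 / 2 : ℝ) < 3 / 4 by norm_num)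
      (show (3 / 4 : ℝ) < 1 by norm_num)] with s hs
    have : Int.fract s = s := Int.fract_eq_self.2 ⟨by linarith [hs.1], hs.2⟩
    rw [doubleLift, this, if_neg hs.1.not_ge]
  have hda : HasDerivAt (doubleLift P Q z₀ d C)
      ((4 * Real.pi : ℝ) • (C * (d * (1 + Complex.I))) • (slope P Q z₀ * z₀ + 1, slope P Q z₀))
      (1 / 4) := by
    have hl : HasDerivAt (fun s : ℝ => 4 * Real.pi * s - Real.pi) (4 * Real.pi) (1 / 4) := by
      simpa using ((hasDerivAt_id (1 / 4 : ℝ)).const_mul (4 * Real.pi)).sub_const Real.pi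
    have h0 : 4 * Real.pi * (1 / 4) - Real.pi = 0 := by ring
    have h1 := hasDerivAt_lift h.den_ne_zero C (4 * Real.pi * (1 / 4) - Real.pi)
    have h2 := (h1.scomp (1 / 4 : ℝ) hl).congr_of_eventuallyEq ha
    rwa [h0, e0, c0, period_zero, Complex.exp_zero, mul_one] at h2
  have hdb : HasDerivAt (doubleLift P Q z₀ d (C * handleFactor P Q z₀ d))
      ((-(4 * Real.pi) : ℝ) • (C * (d * (-1 + Complex.I))) •
        (slope P Q z₀ * z₀ + 1, slope P Q z₀)) (3 / 4) := by
    have hl : HasDerivAt (fun s : ℝ => 2 * Real.pi - 4 * Real.pi * s) (-(4 * Real.pi))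
        (3 / 4) := by
      simpa using ((hasDerivAt_id (3 / 4 : ℝ)).const_mul (4 * Real.pi)).const_sub (2 * Real.pi)
    have h0 : 2 * Real.pi - 4 * Real.pi * (3 / 4) = -Real.pi := by ring
    have h1 := hasDerivAt_lift h.den_ne_zero (C * handleFactor P Q z₀ d *
        Complex.exp (period (slope P Q) z₀ d Real.pi)) (2 * Real.pi - 4 * Real.pi * (3 / 4))
    have h2 := (h1.scomp (3 / 4 : ℝ) hl).congr_of_eventuallyEq hb
    rwa [h0, e1, c1, hfac] at h2
  refine ⟨1 / 4, by norm_num, 3 / 4, by norm_num, ?_, ?_, ?_, ?_, ?_⟩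
  · rw [doubleLift_quarter, doubleLift_three_quarters, Complex.exp_add, ← mul_assoc, hfac]
  · intro s hs t ht hst
    have := doubleLift_eq_doubleLift h hC hst
    rwa [Int.fract_eq_self.2 hs, Int.fract_eq_self.2 ht] at this
  · exact ((contDiff_lift h.den_ne_zero _).comp (by fun_prop)).contDiffAt.congr_of_eventuallyEq ha
  · exact ((contDiff_lift h.den_ne_zero _).comp (by fun_prop)).contDiffAt.congr_of_eventuallyEq hb
  · rw [hda.deriv, hdb.deriv, LinearIndependent.pair_iff]
    intro s t hst
    have hV : ((slope P Q z₀ * z₀ + 1, slope P Q z₀) : ℂ × ℂ) ≠ 0 := by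
      intro h0
      have h2 := congrArg Prod.snd h0
      have h1 := congrArg Prod.fst h0
      simp only [Prod.snd_zero, Prod.fst_zero] at h1 h2
      rw [h2] at h1
      simp at h1
    have h1 : ((4 * Real.pi * (C * d)) * (s * (1 + Complex.I) - t * (-1 + Complex.I)) : ℂ) •
        ((slope P Q z₀ * z₀ + 1, slope P Q z₀) : ℂ × ℂ) = 0 := by
      rw [← hst]
      ext
      · simp only [Prod.fst_add, Prod.smul_fst, smul_eq_mul, Complex.real_smul]
        push_cast
        ring
      · simp only [Prod.snd_add, Prod.smul_snd, smul_eq_mul, Complex.real_smul]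
        push_cast
        ring
    have h2 := (smul_eq_zero.1 h1).resolve_right hV
    have h3 : (4 * Real.pi * (C * d) : ℂ) ≠ 0 := by
      have : (Real.pi : ℂ) ≠ 0 := by exact_mod_cast hpi.ne'
      simp [this, hC, hd]
    have h4 := (mul_eq_zero.1 h2).resolve_left h3
    have h5 := congrArg Complex.re h4
    have h6 := congrArg Complex.im h4
    simp at h5 h6
    constructor <;> linarith

theorem lift_mem_leaf {n : ℕ} (hP : P.IsHomogeneous n) (hQ : Q.IsHomogeneous n)
    (hden : ∀ t, den P Q (contour z₀ d t) ≠ 0) {C : ℂ} (hC : C ≠ 0) {p : ℂ × ℂ}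
    (hp : C • (z₀, (1 : ℂ)) ∈ leaf P Q p) (t : ℝ) : lift P Q z₀ d C t ∈ leaf P Q p := by
  refine mem_leaf_of_image isPreconnected_univ (continuous_lift hP hQ hden hC).continuousOn
    (Set.mem_univ 0) ?_ (Set.mem_univ t)
  rwa [lift_zero]

/-- Each turn around the right lobe stays on the leaf and multiplies y by the same factor. This
provides the base points of the handles. -/
theorem exp_mul_smul_mem_leaf {n : ℕ} (hP : P.IsHomogeneous n) (hQ : Q.IsHomogeneous n)
    (hden : ∀ t, den P Q (contour z₀ d t) ≠ 0) {C : ℂ} (hC : C ≠ 0) {p : ℂ × ℂ}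
    (hp : C • (z₀, (1 : ℂ)) ∈ leaf P Q p) (k : ℕ) :
    (C * Complex.exp (k * period (slope P Q) z₀ d Real.pi)) • (z₀, (1 : ℂ)) ∈ leaf P Q p := by
  induction k with
  | zero => simpa using hp
  | succ k ih =>
    have h := lift_mem_leaf hP hQ hden (mul_ne_zero hC (Complex.exp_ne_zero _)) ih Real.pi
    rw [lift_pi, mul_assoc, ← Complex.exp_add] at h
    convert h using 4
    push_cast
    ring

theorem isLoopOn_doubleLift {n : ℕ} (hP : P.IsHomogeneous n) (hQ : Q.IsHomogeneous n)
    (hden : ∀ t, den P Q (contour z₀ d t) ≠ 0) {C : ℂ} (hC : C ≠ 0) {p : ℂ × ℂ} {s : ℝ}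
    (hp : doubleLift P Q z₀ d C s ∈ leaf P Q p) :
    IsLoopOn P Q (leaf P Q p) (doubleLift P Q z₀ d C) :=
  ⟨periodic_doubleLift C, continuous_doubleLift hP hQ hden hC, fun t =>
    mem_leaf_of_image isPreconnected_univ (continuous_doubleLift hP hQ hden hC).continuousOn
      (Set.mem_univ s) hp (Set.mem_univ t)⟩

/-- The leaf through a point over the centre of a good contour has infinite genus. -/
theorem IsGoodContour.hasInfiniteGenus {n : ℕ} (hP : P.IsHomogeneous n) (hQ : Q.IsHomogeneous n)
    (h : IsGoodContour P Q z₀ d) {C : ℂ} (hC : C ≠ 0) {p : ℂ × ℂ}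
    (hp : C • (z₀, (1 : ℂ)) ∈ leaf P Q p) : HasInfiniteGenus P Q (leaf P Q p) := by
  intro g
  have hcont : Continuous (height P Q z₀ d) := Complex.continuous_re.comp
    (continuous_iff_continuousAt.2 fun t =>
      (hasDerivAt_period (continuous_slope_contour h.den_ne_zero) t).continuousAt)
  have hpi := Real.pi_pos
  obtain ⟨M, hM⟩ := (isCompact_Icc (a := -(2 * Real.pi)) (b := Real.pi)).exists_bound_of_continuousOn
    hcont.continuousOn
  set A := height P Q z₀ d Real.pi with hA
  set B := height P Q z₀ d (-Real.pi) with hB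
  have hA0 : A ≠ 0 := h.right_ne_zero
  have hk : handleFactor P Q z₀ d ≠ 0 := Complex.exp_ne_zero _
  have lmul : ∀ D : ℂ, D ≠ 0 → ∀ w : ℂ, Real.log ‖D * Complex.exp w‖ = Real.log ‖D‖ + w.re :=
    fun D hD w => by
    rw [norm_mul, Real.log_mul (norm_ne_zero_iff.2 hD) (norm_ne_zero_iff.2 (Complex.exp_ne_zero w)),
      Complex.norm_exp, Real.log_exp]
  have bound : ∀ D : ℂ, D ≠ 0 → ∀ s, |Real.log ‖(doubleLift P Q z₀ d D s).2‖ - Real.log ‖D‖| ≤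
      |A| + M := by
    intro D hD s
    rcases doubleLift_cases P Q z₀ d D s with ⟨t, ht, -, hs⟩ | ⟨t, ht, -, hs⟩
    · rw [hs, log_norm_lift_snd hD, add_sub_cancel_left]
      have := hM t ⟨by linarith [ht.1], ht.2⟩
      rw [Real.norm_eq_abs] at this
      linarith [abs_nonneg A]
    · rw [hs, log_norm_lift_snd (mul_ne_zero hD (Complex.exp_ne_zero _)), lmul D hD]
      have := hM t ⟨by linarith [ht.1], by linarith [ht.2]⟩
      rw [Real.norm_eq_abs] at this
      rw [show Real.log ‖D‖ + (period (slope P Q) z₀ d Real.pi).re + height P Q z₀ d t -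
        Real.log ‖D‖ = A + height P Q z₀ d t by simp only [hA, height]; ring]
      linarith [abs_add_le A (height P Q z₀ d t)]
  -- In height the j-th pair of loops stays within |A| + M + |A + B| of log ‖C‖ + N j A. So N |A|
  -- must exceed twice this radius.
  obtain ⟨N, hN⟩ := exists_nat_gt (2 * (|A| + M + |A + B|) / |A|)
  rw [div_lt_iff₀ (abs_pos.2 hA0)] at hN
  let c : Fin g → ℂ := fun j =>
    C * Complex.exp (((N * (j : ℕ) : ℕ) : ℂ) * period (slope P Q) z₀ d Real.pi)
  have hc : ∀ j, c j ≠ 0 := fun j => mul_ne_zero hC (Complex.exp_ne_zero _)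
  have hck : ∀ j, c j * handleFactor P Q z₀ d ≠ 0 := fun j => mul_ne_zero (hc j) hk
  have lc : ∀ j, Real.log ‖c j‖ = Real.log ‖C‖ + N * (j : ℕ) * A := fun j => by
    rw [lmul C hC, hA, height]
    congr 1
    rw [← Complex.ofReal_natCast, Complex.re_ofReal_mul]
    push_cast
    ring
  have near : ∀ j, ∀ x ∈ Set.range (doubleLift P Q z₀ d (c j)) ∪
      Set.range (doubleLift P Q z₀ d (c j * handleFactor P Q z₀ d)),
      |Real.log ‖x.2‖ - (Real.log ‖C‖ + N * (j : ℕ) * A)| ≤ |A| + M + |A + B| := by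
    rintro j x (⟨s, rfl⟩ | ⟨s, rfl⟩)
    · have := bound (c j) (hc j) s
      rw [lc] at this
      linarith [abs_nonneg (A + B)]
    · have h1 := bound _ (hck j) s
      rw [handleFactor, lmul (c j) (hc j), lc] at h1
      have h2 : (-(period (slope P Q) z₀ d Real.pi + period (slope P Q) z₀ d (-Real.pi))).re =
          -(A + B) := by simp only [Complex.neg_re, Complex.add_re, hA, hB, height]
      rw [h2] at h1
      rw [handleFactor]
      rw [abs_le] at h1 ⊢
      constructor <;> linarith [le_abs_self (A + B), neg_abs_le (A + B)]
  refine ⟨fun j => doubleLift P Q z₀ d (c j),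
    fun j => doubleLift P Q z₀ d (c j * handleFactor P Q z₀ d), fun j => ⟨?_, ?_, ?_⟩, ?_⟩
  · refine isLoopOn_doubleLift hP hQ h.den_ne_zero (hc j) (s := 1 / 4) ?_
    rw [doubleLift_quarter]
    exact exp_mul_smul_mem_leaf hP hQ h.den_ne_zero hC hp _
  · refine isLoopOn_doubleLift hP hQ h.den_ne_zero (hck j) (s := 3 / 4) ?_
    rw [doubleLift_three_quarters, handleFactor, mul_assoc, ← Complex.exp_add, neg_add_cancel,
      Complex.exp_zero, mul_one]
    exact exp_mul_smul_mem_leaf hP hQ h.den_ne_zero hC hp _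
  · exact meetTransversallyOnce_doubleLift h (hc j)
  · intro i j hij
    rw [Set.disjoint_left]
    intro x hxi hxj
    have h1 := near i x hxi
    have h2 := near j x hxj
    have h3 : |(N : ℝ) * A * ((i : ℕ) - (j : ℕ) : ℝ)| ≤ 2 * (|A| + M + |A + B|) := by
      rw [abs_le] at h1 h2 ⊢
      constructor <;> nlinarith
    have h4 : (1 : ℝ) ≤ |((i : ℕ) - (j : ℕ) : ℝ)| := by
      have : ((i : ℕ) : ℤ) - (j : ℕ) ≠ 0 := by
        intro h0
        exact hij (Fin.ext (by omega))
      exact_mod_cast Int.one_le_abs this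
    rw [abs_mul, abs_mul, Nat.abs_cast] at h3
    nlinarith [mul_nonneg (Nat.cast_nonneg (α := ℝ) N) (abs_nonneg A)]

end genus

/-! ### All leaves off the invariant lines -/

/-- The polynomial whose values are `den P Q`. -/
def denPoly (P Q : Poly) : Polynomial ℂ :=
  MvPolynomial.aeval ![Polynomial.X, 1] P - Polynomial.X * MvPolynomial.aeval ![Polynomial.X, 1] Q

theorem eval_aeval_X_one (P : Poly) (z : ℂ) :
    (MvPolynomial.aeval ![(Polynomial.X : Polynomial ℂ), 1] P).eval z =
      MvPolynomial.eval ![z, 1] P := by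
  induction P using MvPolynomial.induction_on with
  | C a => simp
  | add p q hp hq => simp [hp, hq]
  | mul_X p i hp => fin_cases i <;> simp [hp]

theorem eval_denPoly (P Q : Poly) (z : ℂ) : (denPoly P Q).eval z = den P Q z := by
  simp [denPoly, den, eval_aeval_X_one]

theorem finite_den_eq_zero {P Q : Poly} {z₁ : ℂ} (h : den P Q z₁ ≠ 0) :
    {z | den P Q z = 0}.Finite := by
  have h0 : denPoly P Q ≠ 0 := fun h0 => h (by rw [← eval_denPoly, h0, Polynomial.eval_zero])
  refine (Polynomial.finite_setOfPred_isRoot h0).subset fun z hz => ?_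
  rw [Set.mem_ofPred_eq, Polynomial.IsRoot, eval_denPoly]
  exact hz

section leaves

variable {P Q : Poly} {n : ℕ}

theorem wedge_field_smul (hP : P.IsHomogeneous n) (hQ : Q.IsHomogeneous n) (y z : ℂ) :
    wedge (field P Q (y • (z, 1))) (y • (z, 1)) = y ^ (n + 1) * den P Q z := by
  rw [field_smul hP hQ]
  simp only [wedge, field, den, Prod.smul_mk, smul_eq_mul, mul_one]
  ring

/-- Only points with y = 0 need an argument: there the leaf is parametrized over the line p + w (0,
1), and a short move makes y nonzero. -/
theorem exists_smul_mem_leaf (hP : P.IsHomogeneous n) (hQ : Q.IsHomogeneous n) {p : ℂ × ℂ}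
    (hp : wedge (field P Q p) p ≠ 0) :
    ∃ y z : ℂ, y ≠ 0 ∧ den P Q z ≠ 0 ∧ y • (z, (1 : ℂ)) ∈ leaf P Q p := by
  have key : ∀ {y z : ℂ} {q : ℂ × ℂ}, q = y • (z, 1) → wedge (field P Q q) q ≠ 0 →
      den P Q z ≠ 0 := by
    rintro y z q rfl hq h0
    rw [wedge_field_smul hP hQ, h0, mul_zero] at hq
    exact hq rfl
  rcases ne_or_eq p.2 0 with h2 | h2
  · have e : p = p.2 • (p.1 / p.2, 1) := by
      ext
      · simp [mul_div_cancel₀ _ h2]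
      · simp
    exact ⟨p.2, p.1 / p.2, h2, key e hp, e ▸ mem_leaf_self P Q p⟩
  · have h1 : p.1 ≠ 0 := by
      intro h1
      simp [wedge, h1, h2] at hp
    have hc : Continuous fun w : ℂ =>
        wedge (field P Q (p + w • ((0, 1) : ℂ × ℂ))) (p + w • (0, 1)) := by
      have hd1 : Differentiable ℂ fun w : ℂ => (p + w • ((0, 1) : ℂ × ℂ)).1 := by
        simp only [Prod.fst_add, Prod.smul_fst]; fun_prop
      have hd2 : Differentiable ℂ fun w : ℂ => (p + w • ((0, 1) : ℂ × ℂ)).2 := by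
        simp only [Prod.snd_add, Prod.smul_snd]; fun_prop
      exact (((differentiable_eval P hd1 hd2).mul hd2).sub
        ((differentiable_eval Q hd1 hd2).mul hd1)).continuous
    have ho : IsOpen {w : ℂ | wedge (field P Q (p + w • ((0, 1) : ℂ × ℂ))) (p + w • (0, 1)) ≠ 0} :=
      isOpen_ne_fun hc continuous_const
    obtain ⟨r, hr, hrS⟩ := Metric.isOpen_iff.1 ho 0
      (by simpa only [Set.mem_ofPred_eq, zero_smul, add_zero] using hp)
    have hdiff : DifferentiableOn ℂ (fun w : ℂ =>
        -(wedge (field P Q (p + w • ((0, 1) : ℂ × ℂ))) (0, 1) /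
          wedge (field P Q (p + w • (0, 1))) (p + w • (0, 1)))) (Metric.ball 0 r) := by
      have hd1 : Differentiable ℂ fun w : ℂ => (p + w • ((0, 1) : ℂ × ℂ)).1 := by
        simp only [Prod.fst_add, Prod.smul_fst]; fun_prop
      have hd2 : Differentiable ℂ fun w : ℂ => (p + w • ((0, 1) : ℂ × ℂ)).2 := by
        simp only [Prod.snd_add, Prod.smul_snd]; fun_prop
      have e1 := differentiable_eval P hd1 hd2
      have e2 := differentiable_eval Q hd1 hd2
      refine DifferentiableOn.neg (DifferentiableOn.div ?_ ?_ fun w hw => hrS hw)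
      · exact ((e1.mul_const 1).sub (e2.mul_const 0)).differentiableOn
      · exact ((e1.mul hd2).sub (e2.mul hd1)).differentiableOn
    obtain ⟨G, hG⟩ := hdiff.isExactOn_ball
    have hcont := continuousOn_exp_smul_line hP hQ (p := p) (v := (0, 1)) (by simpa [wedge] using h1)
      Metric.isOpen_ball (fun w hw => hrS hw) hG (C := Complex.exp (-G 0)) (Complex.exp_ne_zero _)
    have hw : ((r / 2 : ℝ) : ℂ) ∈ Metric.ball (0 : ℂ) r := by
      rw [mem_ball_zero_iff, Complex.norm_real, Real.norm_eq_abs, abs_of_pos (by positivity)]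
      linarith
    have hw0 : ((r / 2 : ℝ) : ℂ) ≠ 0 := by
      have : r / 2 ≠ 0 := by positivity
      exact_mod_cast this
    have hmem := mem_leaf_of_image (convex_ball (0 : ℂ) r).isPreconnected hcont
      (Metric.mem_ball_self hr) (p := p) (by
        rw [← Complex.exp_add, neg_add_cancel, Complex.exp_zero, zero_smul, add_zero, one_smul]
        exact mem_leaf_self P Q p) hw
    generalize ((r / 2 : ℝ) : ℂ) = w at *
    have e : p + w • ((0, 1) : ℂ × ℂ) = w • (p.1 / w, 1) := by
      ext
      · simp [mul_div_cancel₀ _ hw0]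
      · simp [h2]
    refine ⟨Complex.exp (-G 0) * Complex.exp (G w) * w, p.1 / w, ?_, key e (hrS hw), ?_⟩
    · simp [hw0]
    · rwa [e, smul_smul] at hmem

/-- A leaf continues over every disc free of zeros of `den`, and the plane without these finitely
many zeros is connected. -/
theorem exists_smul_mem_leaf_of_den_ne_zero (hP : P.IsHomogeneous n) (hQ : Q.IsHomogeneous n)
    {p : ℂ × ℂ} (hp : wedge (field P Q p) p ≠ 0) {z₁ : ℂ} (hz : den P Q z₁ ≠ 0) :
    ∃ y : ℂ, y ≠ 0 ∧ y • (z₁, (1 : ℂ)) ∈ leaf P Q p := by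
  obtain ⟨y, z, hy, hz', hmem⟩ := exists_smul_mem_leaf hP hQ hp
  have hconn : IsPreconnected {z | den P Q z = 0}ᶜ :=
    ((finite_den_eq_zero hz).countable.isPathConnected_compl_of_one_lt_rank
      (by rw [Complex.rank_real_complex]; norm_num)).isConnected.isPreconnected
  have hopen : IsOpen {z | den P Q z ≠ 0} :=
    isOpen_ne_fun (differentiable_den P Q).continuous continuous_const
  have h := hconn.induction₂ (fun z z' => (∃ y : ℂ, y ≠ 0 ∧ y • (z, (1 : ℂ)) ∈ leaf P Q p) ↔
      ∃ y : ℂ, y ≠ 0 ∧ y • (z', (1 : ℂ)) ∈ leaf P Q p) ?_ (fun _ _ _ _ _ _ h1 h2 => h1.trans h2)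
      (fun _ _ _ _ h => h.symm) hz' hz
  · exact h.1 ⟨y, hy, hmem⟩
  · intro z hz
    obtain ⟨r, hr, hrS⟩ := Metric.isOpen_iff.1 hopen z hz
    obtain ⟨G, hG⟩ : Complex.IsExactOn (slope P Q) (Metric.ball z r) :=
      DifferentiableOn.isExactOn_ball fun z hz =>
        (differentiableAt_slope (hrS hz)).differentiableWithinAt
    have step : ∀ u ∈ Metric.ball z r, ∀ v ∈ Metric.ball z r,
        (∃ y : ℂ, y ≠ 0 ∧ y • (u, (1 : ℂ)) ∈ leaf P Q p) →
        ∃ y : ℂ, y ≠ 0 ∧ y • (v, (1 : ℂ)) ∈ leaf P Q p := by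
      rintro u hu v hv ⟨y, hy, hmem⟩
      have hC : y * Complex.exp (-G u) ≠ 0 := mul_ne_zero hy (Complex.exp_ne_zero _)
      refine ⟨_, mul_ne_zero hC (Complex.exp_ne_zero (G v)), mem_leaf_of_image
        (convex_ball z r).isPreconnected (continuousOn_exp_smul_chart hP hQ Metric.isOpen_ball
          (fun w hw => hrS hw) hG hC) hu ?_ hv⟩
      rwa [mul_assoc, ← Complex.exp_add, neg_add_cancel, Complex.exp_zero, mul_one]
    filter_upwards [mem_nhdsWithin_of_mem_nhds (Metric.ball_mem_nhds z hr)] with z' hz'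
    exact ⟨step z (Metric.mem_ball_self hr) z' hz', step z' hz' z (Metric.mem_ball_self hr)⟩

/-- If there is a good contour, then all but finitely many leaves have infinite genus. -/
theorem IsGoodContour.finite_leaves (hn : n ≠ 0) (hP : P.IsHomogeneous n) (hQ : Q.IsHomogeneous n)
    {z₀ d : ℂ} (h : IsGoodContour P Q z₀ d) :
    {L : Set (ℂ × ℂ) | IsLeaf P Q L ∧ ¬ HasInfiniteGenus P Q L}.Finite := by
  have hz₀ : den P Q z₀ ≠ 0 := by simpa [contour, eight] using h.den_ne_zero 0
  refine (((finite_den_eq_zero hz₀).image fun z => leaf P Q (z, 1)).insert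
    (leaf P Q (1, 0))).subset ?_
  rintro L ⟨⟨p, hp, hL⟩, hgenus⟩
  change L = leaf P Q p at hL
  subst hL
  -- An exceptional leaf lies in an invariant line, hence is the leaf of (z, 1) for a zero z of
  -- `den`, or of (1, 0).
  have hw : wedge (field P Q p) p = 0 := by
    by_contra hw
    obtain ⟨y, hy, hmem⟩ := exists_smul_mem_leaf_of_den_ne_zero hP hQ hw hz₀
    exact hgenus (h.hasInfiniteGenus hP hQ hy hmem)
  have hp0 : p ≠ 0 := by
    rintro rfl
    have := field_smul hP hQ 0 0
    rw [smul_zero, zero_pow hn, zero_smul] at this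
    exact hp this
  rcases ne_or_eq p.2 0 with h2 | h2
  · right
    have e : p = p.2 • (p.1 / p.2, 1) := by
      ext
      · simp [mul_div_cancel₀ _ h2]
      · simp
    refine ⟨p.1 / p.2, ?_, ?_⟩
    · rw [e, wedge_field_smul hP hQ] at hw
      exact (mul_eq_zero.1 hw).resolve_left (pow_ne_zero _ h2)
    · have hm := smul_mem_leaf_of_wedge_eq_zero hP hQ hw hp0 hp (inv_ne_zero h2)
      rw [leaf_eq hm]
      change leaf P Q _ = leaf P Q _
      congr 1
      ext
      · simp [div_eq_inv_mul]
      · simp [h2]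
  · left
    have h1 : p.1 ≠ 0 := fun h1 => hp0 (Prod.ext h1 h2)
    have hm := smul_mem_leaf_of_wedge_eq_zero hP hQ hw hp0 hp (inv_ne_zero h1)
    rw [leaf_eq hm]
    congr 1
    ext
    · simp [h1]
    · simp [h2]

end leaves

/-! ### Openness -/

/-- Nonvanishing of `den` on the compact contour is an open condition, and where it holds the
periods depend continuously on the parameter. -/
theorem isOpen_setOf_isGoodContour {T : Type*} [TopologicalSpace T] {F G : T → Poly}
    (hF : Continuous fun x : T × ℂ => MvPolynomial.eval ![x.2, 1] (F x.1))
    (hG : Continuous fun x : T × ℂ => MvPolynomial.eval ![x.2, 1] (G x.1)) (z₀ d : ℂ) :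
    IsOpen {x | IsGoodContour (F x) (G x) z₀ d} := by
  have hz : Continuous fun x : T × ℝ => contour z₀ d x.2 :=
    (continuous_contour z₀ d).comp continuous_snd
  have hc : Continuous fun x : T × ℝ => (x.1, contour z₀ d x.2) := continuous_fst.prodMk hz
  have hnumF : Continuous fun x : T × ℝ => MvPolynomial.eval ![contour z₀ d x.2, 1] (F x.1) := by
    have := hF.comp hc
    exact this
  have hnum : Continuous fun x : T × ℝ => MvPolynomial.eval ![contour z₀ d x.2, 1] (G x.1) := by
    have := hG.comp hc
    exact this
  have hden : Continuous fun x : T × ℝ => den (F x.1) (G x.1) (contour z₀ d x.2) := by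
    simp only [den]
    exact hnumF.sub (hz.mul hnum)
  have hO : IsOpen {x | ∀ t, den (F x) (G x) (contour z₀ d t) ≠ 0} := by
    have e : {x | ∀ t, den (F x) (G x) (contour z₀ d t) ≠ 0} =
        {x | ∀ t ∈ Set.Icc 0 (2 * Real.pi), den (F x) (G x) (contour z₀ d t) ≠ 0} := by
      ext x
      refine ⟨fun h t _ => h t, fun h t => ?_⟩
      have hp : Function.Periodic (fun t => den (F x) (G x) (contour z₀ d t)) (2 * Real.pi) :=
        fun t => by simp only [contour_add_two_pi]
      obtain ⟨s, hs, hst⟩ := hp.exists_mem_Ico₀ Real.two_pi_pos t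
      rw [show den (F x) (G x) (contour z₀ d t) = den (F x) (G x) (contour z₀ d s) from hst]
      exact h s ⟨hs.1, hs.2.le⟩
    rw [e, isOpen_iff_mem_nhds]
    intro x hx
    exact isCompact_Icc.eventually_forall_of_forall_eventually
      (P := fun x t => den (F x) (G x) (contour z₀ d t) ≠ 0) fun t ht =>
      hden.continuousAt.eventually_ne (hx t ht)
  have hper : ∀ t, Continuous fun x : {x | ∀ t, den (F x) (G x) (contour z₀ d t) ≠ 0} =>
      (period (slope (F x) (G x)) z₀ d t).re := fun t => by
    refine Complex.continuous_re.comp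
      (intervalIntegral.continuous_parametric_intervalIntegral_of_continuous' ?_ 0 t)
    have hc : Continuous fun x : {x | ∀ t, den (F x) (G x) (contour z₀ d t) ≠ 0} × ℝ =>
      ((x.1 : T), x.2) := (continuous_subtype_val.comp continuous_fst).prodMk continuous_snd
    exact ((hnum.comp hc).div (hden.comp hc) fun x => x.1.2 x.2).mul
      (continuous_const.mul (continuous_eightVel.comp continuous_snd))
  have hA := hper Real.pi
  have hB := hper (-Real.pi)
  have h1 : IsOpen {x : {x | ∀ t, den (F x) (G x) (contour z₀ d t) ≠ 0} |
      IsGoodContour (F x) (G x) z₀ d} := by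
    have := (isOpen_ne_fun hA (continuous_const (y := 0))).inter <|
      (isOpen_ne_fun hB (continuous_const (y := 0))).inter <|
      (isOpen_ne_fun (hA.add hB) (continuous_const (y := 0))).inter <|
      (isOpen_ne_fun ((hA.const_mul 2).add hB) (continuous_const (y := 0))).inter <|
      (isOpen_ne_fun (hA.add (hB.const_mul 2)) (continuous_const (y := 0)))
    convert this using 1
    ext x
    exact ⟨fun h => ⟨h.2, h.3, h.4, h.5, h.6⟩, fun h => ⟨x.2, h.1, h.2.1, h.2.2.1, h.2.2.2.1,
      h.2.2.2.2⟩⟩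
  convert hO.isOpenMap_subtype_val _ h1 using 1
  ext x
  exact ⟨fun h => ⟨⟨x, h.1⟩, h, rfl⟩, by rintro ⟨y, hy, rfl⟩; exact hy⟩

/-- The exponents of the monomials of degree at most `n` in two variables (and some more). -/
def exponents (n : ℕ) : Finset (Fin 2 →₀ ℕ) :=
  (Finset.range (n + 1) ×ˢ Finset.range (n + 1)).image fun k =>
    Finsupp.single 0 k.1 + Finsupp.single 1 k.2

theorem support_subset_exponents {n : ℕ} {P : Poly} (hP : P.totalDegree ≤ n) :
    P.support ⊆ exponents n := by
  intro m hm
  have h := (MvPolynomial.le_totalDegree hm).trans hP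
  rw [Finsupp.sum_fintype _ _ (fun _ => rfl), Fin.sum_univ_two] at h
  refine Finset.mem_image.2 ⟨(m 0, m 1), ?_, ?_⟩
  · simp only [Finset.mem_product, Finset.mem_range]
    omega
  · ext i
    fin_cases i <;> simp

/-- The degree bound makes evaluation a sum over one fixed finite set of exponents. -/
theorem continuous_eval_of_coeff {T : Type*} [TopologicalSpace T] {n : ℕ} {F : T → Poly}
    (hdeg : ∀ x, (F x).totalDegree ≤ n)
    (hF : ∀ m, Continuous fun x => MvPolynomial.coeff m (F x)) :
    Continuous fun x : T × ℂ => MvPolynomial.eval ![x.2, 1] (F x.1) := by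
  have e : ∀ x : T × ℂ, MvPolynomial.eval ![x.2, 1] (F x.1) =
      ∑ m ∈ exponents n, MvPolynomial.coeff m (F x.1) * x.2 ^ m 0 := fun x => by
    rw [MvPolynomial.eval_eq', Finset.sum_subset (support_subset_exponents (hdeg x.1))]
    · simp [Fin.prod_univ_two]
    · intro m _ hm
      rw [MvPolynomial.notMem_support_iff.1 hm, zero_mul]
  rw [funext e]
  exact continuous_finsetSum _ fun m _ =>
    ((hF m).comp continuous_fst).mul (continuous_snd.pow _)

theorem totalDegree_le {n : ℕ} (P : MvPolynomial.restrictTotalDegree (Fin 2) ℂ n) :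
    (P : Poly).totalDegree ≤ n :=
  (MvPolynomial.mem_restrictTotalDegree _ _ _).1 P.2

theorem isOpen_good_vectorFields (n : ℕ) (z₀ d : ℂ) :
    IsOpen[coeffTopology n] {X : VF n | IsGoodContour (X.1 : Poly) (X.2 : Poly) z₀ d} := by
  let _ := coeffTopology n
  have hc : Continuous (coeffs n) := continuous_induced_dom
  refine isOpen_setOf_isGoodContour (continuous_eval_of_coeff (fun X : VF n => totalDegree_le X.1) ?_)
    (continuous_eval_of_coeff (fun X : VF n => totalDegree_le X.2) ?_) z₀ d
  · exact fun m => continuous_fst.comp ((continuous_apply m).comp hc)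
  · exact fun m => continuous_snd.comp ((continuous_apply m).comp hc)

/-- Proportional fields have the same `slope`, so goodness depends only on the point of the
projective space. -/
theorem IsGoodContour.smul {P Q : Poly} {z₀ d : ℂ} (h : IsGoodContour P Q z₀ d) {a : ℂ}
    (ha : a ≠ 0) : IsGoodContour (a • P) (a • Q) z₀ d := by
  have hd : ∀ z, den (a • P) (a • Q) z = a * den P Q z := fun z => by
    simp only [den, MvPolynomial.smul_eval]
    ring
  have hs : slope (a • P) (a • Q) = slope P Q := funext fun z => by
    rw [slope, hd, MvPolynomial.smul_eval, mul_div_mul_left _ _ ha, slope]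
  exact ⟨fun t => by rw [hd]; exact mul_ne_zero ha (h.1 t), hs ▸ h.2, hs ▸ h.3, hs ▸ h.4,
    hs ▸ h.5, hs ▸ h.6⟩

/-- The points of the projective space whose representatives have a good contour. -/
def goodSet (n : ℕ) : Set (ProjVF n) :=
  {F | ∃ X : VF n, Represents X F ∧ ∃ z₀ d, IsGoodContour (X.1 : Poly) (X.2 : Poly) z₀ d}

theorem exists_smul_of_represents {n : ℕ} {X Y : VF n} {F : ProjVF n} (hX : Represents X F)
    (hY : Represents Y F) : ∃ a : ℂ, a ≠ 0 ∧ Y = a • X := by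
  obtain ⟨hX0, rfl⟩ := hX
  obtain ⟨hY0, h⟩ := hY
  obtain ⟨a, ha⟩ := (Projectivization.mk_eq_mk_iff ℂ _ _ hY0 hX0).1 h
  exact ⟨a, a.ne_zero, ha.symm⟩

theorem isGoodContour_of_mem_goodSet {n : ℕ} {X : VF n} {F : ProjVF n} (hX : Represents X F)
    (hF : F ∈ goodSet n) : ∃ z₀ d, IsGoodContour (X.1 : Poly) (X.2 : Poly) z₀ d := by
  obtain ⟨Y, hY, z₀, d, h⟩ := hF
  obtain ⟨a, ha, rfl⟩ := exists_smul_of_represents hY hX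
  exact ⟨z₀, d, h.smul ha⟩

theorem isOpen_goodSet (n : ℕ) : IsOpen (goodSet n) := by
  let _ := coeffTopology n
  refine isOpen_coinduced.2 ?_
  have e : Projectivization.mk' ℂ ⁻¹' goodSet n = ((↑) : {X : VF n // X ≠ 0} → VF n) ⁻¹'
      ⋃ z₀, ⋃ d, {X : VF n | IsGoodContour (X.1 : Poly) (X.2 : Poly) z₀ d} := by
    ext X
    simp only [Set.mem_preimage, Set.mem_iUnion]
    have hX : Represents X.1 (Projectivization.mk' ℂ X) := ⟨X.2, rfl⟩
    exact ⟨fun h => isGoodContour_of_mem_goodSet hX h, fun h => ⟨X, hX, h⟩⟩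
  rw [e]
  exact (isOpen_iUnion fun z₀ => isOpen_iUnion fun d => isOpen_good_vectorFields n z₀ d).preimage
    continuous_subtype_val

/-! ### Closures in the projective space -/

theorem mem_closure_of_eventually {n : ℕ} {X Y : VF n} {F : ProjVF n} (hX : Represents X F)
    {S : Set (ProjVF n)}
    (h : ∀ᶠ δ : ℝ in 𝓝[≠] 0, ∃ F' ∈ S, Represents (X + (δ : ℂ) • Y) F') : F ∈ closure S := by
  let _ := coeffTopology n
  obtain ⟨hX0, rfl⟩ := hX
  rw [mem_closure_iff]
  intro V hV hXV
  obtain ⟨W, hW, hWV⟩ := isOpen_induced_iff.1 (isOpen_coinduced.1 hV)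
  have hXW : X ∈ W := by
    have : (⟨X, hX0⟩ : {X : VF n // X ≠ 0}) ∈ ((↑) : {X : VF n // X ≠ 0} → VF n) ⁻¹' W := by
      rw [hWV]
      exact hXV
    exact this
  have hc : Continuous fun δ : ℝ => X + (δ : ℂ) • Y := by
    refine continuous_induced_rng.2 (continuous_pi fun m => ?_)
    have : ∀ δ : ℝ, (coeffs n ∘ fun δ : ℝ => X + (δ : ℂ) • Y) δ m =
        coeffs n X m + (δ : ℂ) • coeffs n Y m := fun δ => by simp [coeffs]
    rw [funext this]
    fun_prop
  have hev : ∀ᶠ δ : ℝ in 𝓝[≠] 0, X + (δ : ℂ) • Y ∈ W :=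
    mem_nhdsWithin_of_mem_nhds (hc.continuousAt.preimage_mem_nhds
      (hW.mem_nhds (by simpa using hXW)))
  obtain ⟨δ, ⟨F', hF', hne, rfl⟩, hδ⟩ := (h.and hev).exists
  refine ⟨_, ?_, hF'⟩
  have : (⟨X + (δ : ℂ) • Y, hne⟩ : {X : VF n // X ≠ 0}) ∈ Projectivization.mk' ℂ ⁻¹' V := by
    rw [← hWV]
    exact hδ
  exact this

/-- An affine function of δ that is not identically zero has at most one zero. All genericity
conditions below have this form. -/
theorem eventually_add_smul_ne_zero {E : Type*} [NormedAddCommGroup E] [NormedSpace ℝ E] {u v : E}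
    (h : u ≠ 0 ∨ v ≠ 0) : ∀ᶠ δ : ℝ in 𝓝[≠] 0, u + δ • v ≠ 0 := by
  by_cases hu : u = 0
  · subst hu
    filter_upwards [self_mem_nhdsWithin] with δ hδ
    simpa using ⟨hδ, h.resolve_left (fun h => h rfl)⟩
  · have hc : Continuous fun δ : ℝ => u + δ • v := by fun_prop
    exact (hc.continuousAt.eventually_ne (x := (0 : ℝ)) (by simpa using hu)).filter_mono
      nhdsWithin_le_nhds

/-! ### Homogeneous vector fields from pairs of univariate polynomials -/

open Polynomial in
/-- The homogeneous vector field of degree `n` that is `(p(x), q(x))` on the line `y = 1`. -/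
def homogenizeVF (n : ℕ) (p q : ℂ[X]) : VF n :=
  (⟨p.homogenize n, (MvPolynomial.mem_restrictTotalDegree _ _ _).2
      (isHomogeneous_homogenize p).totalDegree_le⟩,
    ⟨q.homogenize n, (MvPolynomial.mem_restrictTotalDegree _ _ _).2
      (isHomogeneous_homogenize q).totalDegree_le⟩)

section homogenize

variable {n : ℕ} {p q : Polynomial ℂ}

theorem homogenizeVF_add_smul (n : ℕ) (p q p' q' : Polynomial ℂ) (δ : ℂ) :
    homogenizeVF n (p + δ • p') (q + δ • q') = homogenizeVF n p q + δ • homogenizeVF n p' q' := by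
  refine Prod.ext (Subtype.ext ?_) (Subtype.ext ?_) <;> simp [homogenizeVF]

theorem eval_homogenize_one (hp : p.natDegree ≤ n) (z : ℂ) :
    MvPolynomial.eval ![z, 1] (p.homogenize n) = p.eval z := by
  rw [← eval_aeval_X_one, Polynomial.aeval_homogenize_X_one p hp]

theorem eval_homogenize_zero (p : Polynomial ℂ) (n : ℕ) (x : ℂ) :
    MvPolynomial.eval ![x, 0] (p.homogenize n) = p.coeff n * x ^ n := by
  rw [Polynomial.homogenize, map_sum, Finset.sum_eq_single (n, 0)]
  · simp [MvPolynomial.eval_monomial, Finsupp.prod_fintype]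
  · rintro ⟨a, b⟩ hab hne
    have hb : b ≠ 0 := by
      rintro rfl
      simp at hab
      exact hne (by simp [hab])
    simp [MvPolynomial.eval_monomial, Finsupp.prod_fintype, hb]
  · simp

theorem den_homogenize (hp : p.natDegree ≤ n) (hq : q.natDegree ≤ n) (z : ℂ) :
    den (p.homogenize n) (q.homogenize n) z = (p - Polynomial.X * q).eval z := by
  simp [den, eval_homogenize_one hp, eval_homogenize_one hq]

theorem homogenizeVF_ne_zero (hp : p.natDegree ≤ n) (hq : q.natDegree ≤ n)
    (h : p - Polynomial.X * q ≠ 0) : homogenizeVF n p q ≠ 0 := by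
  intro h0
  have h1 : p.homogenize n = 0 := congrArg (fun X : VF n => (X.1 : Poly)) h0
  have h2 : q.homogenize n = 0 := congrArg (fun X : VF n => (X.2 : Poly)) h0
  rw [Polynomial.eq_zero_of_homogenize_eq_zero hp h1,
    Polynomial.eq_zero_of_homogenize_eq_zero hq h2] at h
  simp at h

/-- Two polynomials without common zeros off the origin are relatively prime. -/
theorem isRelPrime_of_common_zeros {P Q : Poly}
    (h : ∀ x, MvPolynomial.eval x P = 0 → MvPolynomial.eval x Q = 0 → x = 0) :
    IsRelPrime P Q := by
  intro D hP hQ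
  -- A common divisor vanishes at most at the origin, so by the Nullstellensatz it divides powers of
  -- both variables and is a unit.
  have key : ∀ i, ∃ k, D ∣ (MvPolynomial.X i : Poly) ^ k := fun i => by
    have hmem : (MvPolynomial.X i : Poly) ∈ MvPolynomial.vanishingIdeal ℂ
        (MvPolynomial.zeroLocus ℂ (Ideal.span {D})) := by
      intro x hx
      have hD : MvPolynomial.eval x D = 0 := by
        simpa using hx D (Ideal.mem_span_singleton_self D)
      have hx0 : x = 0 := by
        obtain ⟨P', rfl⟩ := hP
        obtain ⟨Q', rfl⟩ := hQ
        exact h x (by simp [hD]) (by simp [hD])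
      simp [hx0]
    rw [MvPolynomial.vanishingIdeal_zeroLocus_eq_radical] at hmem
    obtain ⟨k, hk⟩ := hmem
    exact ⟨k, Ideal.mem_span_singleton.1 hk⟩
  obtain ⟨k, hk⟩ := key 0
  obtain ⟨l, hl⟩ := key 1
  have p0 : Prime (MvPolynomial.X 0 : Poly) := MvPolynomial.X_prime
  obtain ⟨i, -, hi⟩ := (dvd_prime_pow p0 k).1 hk
  rcases Nat.eq_zero_or_pos i with rfl | hpos
  · simpa using hi.symm.isUnit
  · have h1 : (MvPolynomial.X 0 : Poly) ∣ MvPolynomial.X 1 ^ l :=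
      (dvd_pow_self _ hpos.ne').trans (hi.symm.dvd.trans hl)
    obtain ⟨E, hE⟩ := h1
    have := congrArg (MvPolynomial.eval ![0, 1]) hE
    simp at this

/-- A common zero with y ≠ 0 scales to a common root of p and q. On y = 0 the form of q is its n-th
coefficient times x^n. -/
theorem isRelPrime_homogenize (hp : p.natDegree ≤ n) (hq : q.natDegree ≤ n)
    (hc : q.coeff n ≠ 0) (hpq : ∀ z, p.eval z = 0 → q.eval z ≠ 0) :
    IsRelPrime (p.homogenize n) (q.homogenize n) := by
  refine isRelPrime_of_common_zeros fun v h1 h2 => ?_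
  have hv : v = ![v 0, v 1] := by ext i; fin_cases i <;> rfl
  rw [hv] at h1 h2 ⊢
  generalize v 0 = x at *
  generalize v 1 = y at *
  rcases eq_or_ne y 0 with rfl | hy
  · rw [eval_homogenize_zero] at h2
    have := eq_zero_of_pow_eq_zero ((mul_eq_zero.1 h2).resolve_left hc)
    subst this
    ext i
    fin_cases i <;> rfl
  · have e : (![x, y] : Fin 2 → ℂ) = ![y * (x / y), y * 1] := by
      rw [mul_div_cancel₀ _ hy, mul_one]
    rw [e, eval_smul_of_isHomogeneous (Polynomial.isHomogeneous_homogenize _)] at h1 h2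
    have h1' := (mul_eq_zero.1 h1).resolve_left (pow_ne_zero _ hy)
    have h2' := (mul_eq_zero.1 h2).resolve_left (pow_ne_zero _ hy)
    rw [eval_homogenize_one hp] at h1'
    rw [eval_homogenize_one hq] at h2'
    exact absurd h2' (hpq _ h1')

theorem exists_eq_homogenizeVF {X : VF n} (h1 : (X.1 : Poly).IsHomogeneous n)
    (h2 : (X.2 : Poly).IsHomogeneous n) :
    ∃ p q : Polynomial ℂ, p.natDegree ≤ n ∧ q.natDegree ≤ n ∧ X = homogenizeVF n p q := by
  have hdeg : ∀ P : Poly, P.IsHomogeneous n →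
      (MvPolynomial.aeval ![(Polynomial.X : Polynomial ℂ), 1] P).natDegree ≤ n := fun P hP => by
    have := MvPolynomial.aeval_natDegree_le P hP.totalDegree_le
      ![(Polynomial.X : Polynomial ℂ), 1] (n := 1) (fun i => by fin_cases i <;> simp)
    rwa [mul_one] at this
  refine ⟨_, _, hdeg _ h1, hdeg _ h2, Prod.ext (Subtype.ext ?_) (Subtype.ext ?_)⟩
  · exact (Polynomial.homogenize_eq_of_isHomogeneous h1 rfl).symm
  · exact (Polynomial.homogenize_eq_of_isHomogeneous h2 rfl).symm

end homogenize

/-! ### Separability after a perturbation -/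

-- For S = X^(n+1) - c with no root in common with R, a multiple root of R + δ S is a zero of the
-- Wronskian R' S - R S'. That has finitely many zeros, and each of them is a root of R + δ S for at
-- most one δ.
open Polynomial in
theorem eventually_simple_roots (n : ℕ) (hn : n ≠ 0) (R : ℂ[X]) (hR : R.natDegree ≤ n + 1) :
    ∃ c : ℂ, ∀ᶠ δ : ℝ in 𝓝[≠] 0,
      (R + (δ : ℂ) • (X ^ (n + 1) - C c)).natDegree = n + 1 ∧
      (R + (δ : ℂ) • (X ^ (n + 1) - C c)).roots.toFinset.card = n + 1 := by
  obtain ⟨c, hc⟩ : ∃ c : ℂ, c ∉ insert 0 (R.roots.toFinset.image fun r => r ^ (n + 1)) :=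
    Infinite.exists_notMem_finset _
  simp only [Finset.mem_insert, Finset.mem_image, Multiset.mem_toFinset, not_or, not_exists,
    not_and] at hc
  obtain ⟨hc0, hcr⟩ := hc
  refine ⟨c, ?_⟩
  set S : ℂ[X] := X ^ (n + 1) - C c with hS
  have hSc : S.coeff (n + 1) = 1 := by simp [hS]
  have hSd : S.natDegree ≤ n + 1 := by rw [hS]; exact natDegree_X_pow_sub_C.le
  have hS' : S.derivative = C ((n : ℂ) + 1) * X ^ n := by simp [hS]
  have hev : ∀ᶠ δ : ℝ in 𝓝[≠] 0, ∀ z, (R + (δ : ℂ) • S).eval z = 0 →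
      (R + (δ : ℂ) • S).derivative.eval z ≠ 0 := by
    -- For R = 0 the Wronskian vanishes identically, but δ S has simple roots because c ≠ 0.
    by_cases hR0 : R = 0
    · filter_upwards [self_mem_nhdsWithin] with δ hδ z h1 h2
      have hδ' : (δ : ℂ) ≠ 0 := by exact_mod_cast hδ
      rw [hR0] at h1 h2
      have hn1 : (n : ℂ) + 1 ≠ 0 := by exact_mod_cast n.succ_ne_zero
      simp only [zero_add, derivative_smul, hS', eval_smul, smul_eq_mul, eval_mul, eval_C,
        eval_pow, eval_X, mul_eq_zero, hδ', false_or, hn1] at h1 h2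
      rw [pow_eq_zero_iff hn] at h2
      rw [h2] at h1
      simp [hS, hc0] at h1
    · set W := R.derivative * S - R * S.derivative with hW
      have hW0 : W ≠ 0 := by
        intro h0
        obtain ⟨s, hs⟩ := IsAlgClosed.exists_pow_nat_eq c (Nat.succ_pos n)
        have hs0 : s ≠ 0 := by
          rintro rfl
          exact hc0 (by rw [← hs]; simp)
        have hRs : R.eval s ≠ 0 := fun h => hcr s ((mem_roots hR0).2 h) hs
        have h1 := congrArg (eval s) h0
        have hn1 : (n : ℂ) + 1 ≠ 0 := by exact_mod_cast n.succ_ne_zero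
        have hSs : S.eval s = 0 := by simp [hS, ← hs]
        rw [hW, hS'] at h1
        simp [hSs, hRs, hs0, hn1] at h1
      have h1 : ∀ᶠ δ : ℝ in 𝓝[≠] 0, ∀ z ∈ W.roots.toFinset,
          R.eval z + δ • S.eval z ≠ 0 := by
        rw [Filter.eventually_all_finset]
        intro z _
        refine eventually_add_smul_ne_zero ?_
        by_contra! h
        refine hcr z ((mem_roots hR0).2 h.1) ?_
        have := h.2
        simp only [hS, eval_sub, eval_pow, eval_X, eval_C] at this
        exact sub_eq_zero.1 this
      filter_upwards [h1] with δ hδ z h2 h3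
      simp only [derivative_add, derivative_smul, eval_add, eval_smul, smul_eq_mul] at h2 h3
      refine hδ z ?_ (by rw [Complex.real_smul]; exact h2)
      rw [Multiset.mem_toFinset, mem_roots hW0, IsRoot, hW]
      simp only [eval_sub, eval_mul]
      linear_combination S.eval z * h3 - S.derivative.eval z * h2
  have hco : ∀ᶠ δ : ℝ in 𝓝[≠] 0, R.coeff (n + 1) + δ • (1 : ℂ) ≠ 0 :=
    eventually_add_smul_ne_zero (Or.inr one_ne_zero)
  filter_upwards [hev, hco] with δ h1 h2
  have hdeg : (R + (δ : ℂ) • S).natDegree = n + 1 := by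
    refine natDegree_eq_of_le_of_coeff_ne_zero
      (natDegree_add_le_of_degree_le hR ((natDegree_smul_le _ _).trans hSd)) ?_
    rw [coeff_add, coeff_smul, hSc]
    simpa using h2
  refine ⟨hdeg, ?_⟩
  have hne : R + (δ : ℂ) • S ≠ 0 := by
    intro h0
    rw [h0, natDegree_zero] at hdeg
    omega
  have hnodup : (R + (δ : ℂ) • S).roots.Nodup := by
    rw [Multiset.nodup_iff_count_le_one]
    intro z
    rw [count_roots]
    by_contra! hlt
    have := (one_lt_rootMultiplicity_iff_isRoot hne).1 hlt
    exact h1 z this.1 this.2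
  rw [Multiset.toFinset_card_of_nodup hnodup, IsAlgClosed.card_roots_eq_natDegree, hdeg]

/-! ### Density -/

section poles

variable {z₀ d : ℂ}

theorem contour_sub (hd : d ≠ 0) (ζ : ℂ) (t : ℝ) :
    contour z₀ d t - ζ = d * (eight t - (ζ - z₀) / d) := by
  rw [contour]
  field_simp
  ring

theorem period_inv_sub (hd : d ≠ 0) (ζ : ℂ) (t : ℝ) :
    period (fun z => (z - ζ)⁻¹) z₀ d t = ∫ τ in 0..t, eightVel τ / (eight τ - (ζ - z₀) / d) := by
  refine intervalIntegral.integral_congr fun τ _ => ?_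
  simp only
  rw [contour_sub hd, mul_inv, div_eq_inv_mul]
  field_simp

theorem period_linear {ι : Type*} (s : Finset ι) (c : ι → ℂ) (g : ι → ℂ → ℂ)
    (hg : ∀ i ∈ s, Continuous fun t => g i (contour z₀ d t)) {f : ℂ → ℂ}
    (hf : ∀ t, f (contour z₀ d t) = ∑ i ∈ s, c i * g i (contour z₀ d t)) (t : ℝ) :
    period f z₀ d t = ∑ i ∈ s, c i * period (g i) z₀ d t := by
  simp only [period, hf, Finset.sum_mul]
  rw [intervalIntegral.integral_finsetSum]
  · refine Finset.sum_congr rfl fun i _ => ?_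
    rw [← intervalIntegral.integral_const_mul]
    simp only [mul_assoc]
  · intro i hi
    exact (continuous_period_integrand
      (g := fun z => c i * g i z) (continuous_const.mul (hg i hi))).intervalIntegrable _ _

end poles

open Polynomial in
/-- Near three roots of a polynomial there is a figure eight and a differential form with
prescribed periods. -/
theorem exists_contour (n : ℕ) (R : ℂ[X]) (hR : R.natDegree = n + 1)
    (hcard : 3 ≤ R.roots.toFinset.card) :
    ∃ (z₀ d : ℂ) (T : ℂ[X]), T.natDegree ≤ n - 1 ∧ (∀ t, R.eval (contour z₀ d t) ≠ 0) ∧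
      period (fun z => T.eval z / R.eval z) z₀ d Real.pi = 1 ∧
      period (fun z => T.eval z / R.eval z) z₀ d (-Real.pi) = 1 := by
  have hR0 : R ≠ 0 := by
    rintro rfl
    simp at hcard
  set s := R.roots.toFinset with hs
  have hroot : ∀ z, R.eval z = 0 ↔ z ∈ s := fun z => by
    rw [hs, Multiset.mem_toFinset, mem_roots hR0, IsRoot]
  have hoff : s.offDiag.Nonempty := by
    obtain ⟨u, hu, v, hv, huv⟩ := Finset.one_lt_card.1 (show 1 < s.card by omega)
    exact ⟨(u, v), Finset.mem_offDiag.2 ⟨hu, hv, huv⟩⟩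
  -- For a closest pair of roots, scaled to ±1/2, any other root is at distance at least 1 from both
  -- centres, hence outside both lobes.
  obtain ⟨⟨z₁, z₂⟩, h12, hmin⟩ := s.offDiag.exists_min_image (fun p => ‖p.1 - p.2‖) hoff
  rw [Finset.mem_offDiag] at h12
  obtain ⟨h1, h2, hne⟩ := h12
  simp only at h1 h2 hne hmin
  obtain ⟨z₃, h3⟩ : ((s.erase z₁).erase z₂).Nonempty := by
    rw [← Finset.card_pos, Finset.card_erase_of_mem (Finset.mem_erase.2 ⟨hne.symm, h2⟩),
      Finset.card_erase_of_mem h1]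
    omega
  rw [Finset.mem_erase, Finset.mem_erase] at h3
  obtain ⟨h32, h31, h3⟩ := h3
  set d := z₁ - z₂ with hd
  have hd0 : d ≠ 0 := sub_ne_zero.2 hne
  set z₀ := (z₁ + z₂) / 2 with hz₀
  have e1 : (z₁ - z₀) / d = 1 / 2 := by
    rw [div_eq_iff hd0, hz₀, hd]; ring
  have e2 : (z₂ - z₀) / d = -(1 / 2) := by
    rw [div_eq_iff hd0, hz₀, hd]; ring
  have far1 : ∀ ζ ∈ s, ζ ≠ z₁ → 1 ≤ ‖(ζ - z₀) / d - 1 / 2‖ := fun ζ hζ h => by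
    rw [← e1, ← sub_div, norm_div, one_le_div (norm_pos_iff.2 hd0)]
    have := hmin (ζ, z₁) (Finset.mem_offDiag.2 ⟨hζ, h1, h⟩)
    simpa using this
  have far2 : ∀ ζ ∈ s, ζ ≠ z₂ → 1 ≤ ‖(ζ - z₀) / d + 1 / 2‖ := fun ζ hζ h => by
    rw [← sub_neg_eq_add, ← e2, ← sub_div, norm_div, one_le_div (norm_pos_iff.2 hd0)]
    have := hmin (ζ, z₂) (Finset.mem_offDiag.2 ⟨hζ, h2, h⟩)
    simpa using this
  have havoid : ∀ ζ ∈ s, ∀ t, contour z₀ d t - ζ ≠ 0 := by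
    intro ζ hζ t
    rw [contour_sub hd0]
    refine mul_ne_zero hd0 (sub_ne_zero.2 ?_)
    by_cases hζ1 : ζ = z₁
    · rw [hζ1, e1]
      exact eight_ne_half t
    by_cases hζ2 : ζ = z₂
    · rw [hζ2, e2]
      exact eight_ne_neg_half t
    exact eight_ne_of_far (far1 ζ hζ hζ1) (far2 ζ hζ hζ2) t
  have hRc : ∀ t, R.eval (contour z₀ d t) ≠ 0 := fun t h0 =>
    havoid _ ((hroot _).1 h0) t (sub_self _)
  have right_zero : ∀ ζ ∈ s, ζ ≠ z₁ → period (fun z => (z - ζ)⁻¹) z₀ d Real.pi = 0 :=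
    fun ζ hζ h => by rw [period_inv_sub hd0, integral_eightVel_of_far (far1 ζ hζ h)]
  have left_zero : ∀ ζ ∈ s, ζ ≠ z₂ → period (fun z => (z - ζ)⁻¹) z₀ d (-Real.pi) = 0 :=
    fun ζ hζ h => by
      rw [period_inv_sub hd0, integral_eightVel_div_neg, integral_eightVel_of_far]
      rw [show -((ζ - z₀) / d) - 1 / 2 = -((ζ - z₀) / d + 1 / 2) by ring, norm_neg]
      exact far2 ζ hζ h
  have right_one : period (fun z => (z - z₁)⁻¹) z₀ d Real.pi = -(2 * Real.pi * Complex.I) := by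
    rw [period_inv_sub hd0, e1, integral_eightVel_half]
  have left_two : period (fun z => (z - z₂)⁻¹) z₀ d (-Real.pi) = -(2 * Real.pi * Complex.I) := by
    rw [period_inv_sub hd0, e2, integral_eightVel_div_neg, neg_neg, integral_eightVel_half]
  have hW : (-(2 * Real.pi * Complex.I) : ℂ) ≠ 0 := neg_ne_zero.2 Complex.two_pi_I_ne_zero
  generalize (-(2 * Real.pi * Complex.I) : ℂ) = W at *
  have split : ∀ u ∈ s, ∀ v ∈ s, u ≠ v → ∃ K : ℂ[X], R = (X - C u) * (X - C v) * K ∧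
      K.natDegree ≤ n - 1 := by
    intro u hu v hv huv
    obtain ⟨K, hK⟩ : (X - C u) * (X - C v) ∣ R :=
      (isCoprime_X_sub_C_of_isUnit_sub (sub_ne_zero.2 huv).isUnit).mul_dvd
        (dvd_iff_isRoot.2 ((hroot u).2 hu)) (dvd_iff_isRoot.2 ((hroot v).2 hv))
    refine ⟨K, hK, ?_⟩
    have hK0 : K ≠ 0 := by
      rintro rfl
      exact hR0 (by rw [hK, mul_zero])
    rw [hK, natDegree_mul (mul_ne_zero (X_sub_C_ne_zero u) (X_sub_C_ne_zero v)) hK0,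
      natDegree_mul (X_sub_C_ne_zero u) (X_sub_C_ne_zero v), natDegree_X_sub_C,
      natDegree_X_sub_C] at hR
    omega
  obtain ⟨K₁, hK₁, hK₁d⟩ := split z₁ h1 z₃ h3 (Ne.symm h31)
  obtain ⟨K₂, hK₂, hK₂d⟩ := split z₂ h2 z₃ h3 (Ne.symm h32)
  have frac : ∀ u ∈ s, ∀ v ∈ s, ∀ K : ℂ[X], R = (X - C u) * (X - C v) * K → ∀ t,
      (u - v) * K.eval (contour z₀ d t) / R.eval (contour z₀ d t) =
        (contour z₀ d t - u)⁻¹ - (contour z₀ d t - v)⁻¹ := by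
    intro u hu v hv K hK t
    have hu' := havoid u hu t
    have hv' := havoid v hv t
    have hR' := hRc t
    have e : R.eval (contour z₀ d t) = (contour z₀ d t - u) * (contour z₀ d t - v) *
        K.eval (contour z₀ d t) := by
      conv_lhs => rw [hK]
      simp
    rw [e] at hR' ⊢
    have hK' := right_ne_zero_of_mul hR'
    field_simp
    ring
  -- This is T / R = W⁻¹ (1/(z - z₁) + 1/(z - z₂) - 2/(z - z₃)). The pole at z₃ makes the residues
  -- sum to zero, which lowers the degree of T to n - 1, so that X T still has degree at most n.
  refine ⟨z₀, d, W⁻¹ • ((z₁ - z₃) • K₁ + (z₂ - z₃) • K₂), ?_, hRc, ?_⟩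
  · refine (natDegree_smul_le _ _).trans (natDegree_add_le_of_degree_le ?_ ?_)
    · exact (natDegree_smul_le _ _).trans hK₁d
    · exact (natDegree_smul_le _ _).trans hK₂d
  have hcont : ∀ i : Fin 3, Continuous fun t => (contour z₀ d t - ![z₁, z₂, z₃] i)⁻¹ := fun i => by
    refine ((continuous_contour z₀ d).sub continuous_const).inv₀ fun t => havoid _ ?_ t
    fin_cases i <;> assumption
  have hsum : ∀ t, (W⁻¹ • ((z₁ - z₃) • K₁ + (z₂ - z₃) • K₂)).eval (contour z₀ d t) /
      R.eval (contour z₀ d t) = ∑ i : Fin 3, ![W⁻¹, W⁻¹, -2 * W⁻¹] i *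
        (contour z₀ d t - ![z₁, z₂, z₃] i)⁻¹ := fun t => by
    have f1 := frac z₁ h1 z₃ h3 K₁ hK₁ t
    have f2 := frac z₂ h2 z₃ h3 K₂ hK₂ t
    simp only [Fin.sum_univ_three, Matrix.cons_val_zero, Matrix.cons_val_one, Matrix.cons_val,
      eval_smul, eval_add, smul_eq_mul]
    rw [mul_div_assoc, add_div, f1, f2]
    ring
  have hlin := period_linear (f := fun z => (W⁻¹ • ((z₁ - z₃) • K₁ + (z₂ - z₃) • K₂)).eval z /
    R.eval z) Finset.univ ![W⁻¹, W⁻¹, -2 * W⁻¹] (fun i z => (z - ![z₁, z₂, z₃] i)⁻¹)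
    (fun i _ => hcont i) hsum
  rw [hlin, hlin]
  simp only [Fin.sum_univ_three, Matrix.cons_val_zero, Matrix.cons_val_one, Matrix.cons_val]
  rw [right_one, left_two, right_zero z₂ h2 hne.symm, right_zero z₃ h3 h31,
    left_zero z₁ h1 hne, left_zero z₃ h3 h32, inv_mul_cancel₀ hW]
  simp

/-! ### The three perturbations -/

section density

variable {n : ℕ} {p q : Polynomial ℂ} {F : ProjVF n}

theorem coeff_ne_zero_of_natDegree (hp : p.natDegree ≤ n)
    (hR : (p - Polynomial.X * q).natDegree = n + 1) : q.coeff n ≠ 0 := by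
  intro h0
  have h1 : (p - Polynomial.X * q).coeff (n + 1) ≠ 0 := by
    rw [← hR, Polynomial.coeff_natDegree, Polynomial.leadingCoeff_ne_zero]
    intro h
    rw [h, Polynomial.natDegree_zero] at hR
    omega
  refine h1 ?_
  rw [Polynomial.coeff_sub, Polynomial.coeff_X_mul, h0,
    Polynomial.coeff_eq_zero_of_natDegree_lt (by omega), sub_zero]

/-- A common root of p and q would be a root of p - X q at which q vanishes. -/
theorem mem_homogeneousFoliations (hp : p.natDegree ≤ n) (hq : q.natDegree ≤ n)
    (hR : (p - Polynomial.X * q).natDegree = n + 1)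
    (hqR : ∀ z, (p - Polynomial.X * q).eval z = 0 → q.eval z ≠ 0)
    (hF : Represents (homogenizeVF n p q) F) : F ∈ homogeneousFoliations n := by
  refine ⟨⟨_, hF, isRelPrime_homogenize hp hq (coeff_ne_zero_of_natDegree hp hR) ?_⟩,
    _, hF, Polynomial.isHomogeneous_homogenize p, Polynomial.isHomogeneous_homogenize q⟩
  intro z hpz hqz
  exact hqR z (by simp [hpz, hqz]) hqz

theorem represents_mk {X : VF n} (hX : X ≠ 0) : Represents X (Projectivization.mk ℂ X hX) :=
  ⟨hX, rfl⟩

theorem natDegree_add_smul_le {p' : Polynomial ℂ} (hp : p.natDegree ≤ n) (hp' : p'.natDegree ≤ n)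
    (δ : ℂ) : (p + δ • p').natDegree ≤ n :=
  Polynomial.natDegree_add_le_of_degree_le hp ((Polynomial.natDegree_smul_le _ _).trans hp')

theorem ne_zero_of_natDegree_eq {R : Polynomial ℂ} (hR : R.natDegree = n + 1) : R ≠ 0 := by
  rintro rfl
  simp at hR

/-- Adding δ (X T, T) keeps p - X q, hence the contour, and adds δ T / R to `slope`, so both periods
grow by δ. The five real linear forms become affine in δ with slopes 1, 1, 2, 3, 3. -/
theorem mem_closure_of_eval_ne_zero (hn : n ≠ 0) (hp : p.natDegree ≤ n) (hq : q.natDegree ≤ n)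
    (hR : (p - Polynomial.X * q).natDegree = n + 1)
    (hcard : 3 ≤ (p - Polynomial.X * q).roots.toFinset.card)
    (hqR : ∀ z, (p - Polynomial.X * q).eval z = 0 → q.eval z ≠ 0)
    (hF : Represents (homogenizeVF n p q) F) :
    F ∈ closure (goodSet n ∩ homogeneousFoliations n) := by
  obtain ⟨z₀, d, T, hT, hc, hpr, hpl⟩ := exists_contour n _ hR hcard
  have hR0 := ne_zero_of_natDegree_eq hR
  have hTn : T.natDegree ≤ n := by omega
  have hXT : (Polynomial.X * T).natDegree ≤ n :=
    Polynomial.natDegree_mul_le.trans (by rw [Polynomial.natDegree_X]; omega)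
  have hRδ : ∀ δ : ℂ, p + δ • (Polynomial.X * T) - Polynomial.X * (q + δ • T) =
      p - Polynomial.X * q := fun δ => by
    rw [mul_add, mul_smul_comm]
    abel
  have hper : ∀ (δ : ℂ) (t : ℝ), period
      (slope ((p + δ • (Polynomial.X * T)).homogenize n) ((q + δ • T).homogenize n)) z₀ d t =
      period (slope (p.homogenize n) (q.homogenize n)) z₀ d t +
        δ * period (fun z => T.eval z / (p - Polynomial.X * q).eval z) z₀ d t := by
    intro δ t
    have hpδ := natDegree_add_smul_le hp hXT δ
    have hqδ := natDegree_add_smul_le hq hTn δ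
    have hden : ∀ t, den (p.homogenize n) (q.homogenize n) (contour z₀ d t) ≠ 0 := fun t => by
      rw [den_homogenize hp hq]; exact hc t
    have h1 := continuous_slope_contour hden
    have h2 : Continuous fun t => T.eval (contour z₀ d t) /
        (p - Polynomial.X * q).eval (contour z₀ d t) :=
      (T.continuous.comp (continuous_contour z₀ d)).div
        ((p - Polynomial.X * q).continuous.comp (continuous_contour z₀ d)) hc
    have h := period_linear (z₀ := z₀) (d := d)
      (f := slope ((p + δ • (Polynomial.X * T)).homogenize n) ((q + δ • T).homogenize n))
      Finset.univ ![1, δ] ![slope (p.homogenize n) (q.homogenize n),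
        fun z => T.eval z / (p - Polynomial.X * q).eval z] (fun i _ => by
          fin_cases i
          · exact h1
          · exact h2) (fun t => by
          simp only [Fin.sum_univ_two, Matrix.cons_val_zero, Matrix.cons_val_one, slope]
          rw [den_homogenize hpδ hqδ, hRδ, den_homogenize hp hq, eval_homogenize_one hqδ,
            eval_homogenize_one hq, Polynomial.eval_add, Polynomial.eval_smul, smul_eq_mul]
          ring) t
    rw [h]
    simp only [Fin.sum_univ_two, Matrix.cons_val_zero, Matrix.cons_val_one, one_mul]
  have hre : ∀ (δ : ℝ) (t : ℝ), t = Real.pi ∨ t = -Real.pi → (period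
      (slope ((p + (δ : ℂ) • (Polynomial.X * T)).homogenize n)
        ((q + (δ : ℂ) • T).homogenize n)) z₀ d t).re =
      (period (slope (p.homogenize n) (q.homogenize n)) z₀ d t).re + δ := by
    rintro δ t (rfl | rfl)
    · rw [hper, hpr, mul_one, Complex.add_re, Complex.ofReal_re]
    · rw [hper, hpl, mul_one, Complex.add_re, Complex.ofReal_re]
  have hA := fun δ => hre δ Real.pi (Or.inl rfl)
  have hB := fun δ => hre δ (-Real.pi) (Or.inr rfl)
  generalize (period (slope (p.homogenize n) (q.homogenize n)) z₀ d Real.pi).re = A at hA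
  generalize (period (slope (p.homogenize n) (q.homogenize n)) z₀ d (-Real.pi)).re = B at hB
  have ev : ∀ u v : ℝ, v ≠ 0 → ∀ᶠ δ : ℝ in 𝓝[≠] 0, u + δ • v ≠ 0 := fun u v hv =>
    eventually_add_smul_ne_zero (Or.inr hv)
  have evq : ∀ᶠ δ : ℝ in 𝓝[≠] 0, ∀ z ∈ (p - Polynomial.X * q).roots.toFinset,
      q.eval z + δ • T.eval z ≠ 0 := by
    rw [Filter.eventually_all_finset]
    intro z hz
    rw [Multiset.mem_toFinset, Polynomial.mem_roots hR0] at hz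
    exact eventually_add_smul_ne_zero (Or.inl (hqR z hz))
  refine mem_closure_of_eventually (Y := homogenizeVF n (Polynomial.X * T) T) hF ?_
  filter_upwards [evq, ev A 1 one_ne_zero, ev B 1 one_ne_zero, ev (A + B) 2 two_ne_zero,
    ev (2 * A + B) 3 three_ne_zero, ev (A + 2 * B) 3 three_ne_zero] with δ h0 h1 h2 h3 h4 h5
  rw [← homogenizeVF_add_smul]
  have hpδ := natDegree_add_smul_le hp hXT δ
  have hqδ := natDegree_add_smul_le hq hTn δ
  have hrep := represents_mk (homogenizeVF_ne_zero hpδ hqδ (by rwa [hRδ]))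
  refine ⟨_, ⟨⟨_, hrep, z₀, d, ?_, ?_, ?_, ?_, ?_, ?_⟩,
    mem_homogeneousFoliations hpδ hqδ (by rwa [hRδ]) ?_ hrep⟩, hrep⟩
  · intro t
    rw [homogenizeVF, den_homogenize hpδ hqδ, hRδ]
    exact hc t
  · simp only [homogenizeVF, hA]
    simpa using h1
  · simp only [homogenizeVF, hB]
    simpa using h2
  · simp only [homogenizeVF, hA, hB]
    convert h3 using 1
    rw [smul_eq_mul]; ring
  · simp only [homogenizeVF, hA, hB]
    convert h4 using 1
    rw [smul_eq_mul]; ring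
  · simp only [homogenizeVF, hA, hB]
    convert h5 using 1
    rw [smul_eq_mul]; ring
  · intro z hz
    rw [hRδ] at hz
    have := h0 z (by rwa [Multiset.mem_toFinset, Polynomial.mem_roots hR0])
    rwa [Polynomial.eval_add, Polynomial.eval_smul, smul_eq_mul, ← Complex.real_smul]

/-- Adding δ (X, 1), a multiple of the radial field, keeps p - X q and moves q away from zero at its
roots. -/
theorem mem_closure_of_card_roots (hn : n ≠ 0) (hp : p.natDegree ≤ n) (hq : q.natDegree ≤ n)
    (hR : (p - Polynomial.X * q).natDegree = n + 1)
    (hcard : 3 ≤ (p - Polynomial.X * q).roots.toFinset.card)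
    (hF : Represents (homogenizeVF n p q) F) :
    F ∈ closure (goodSet n ∩ homogeneousFoliations n) := by
  have hR0 := ne_zero_of_natDegree_eq hR
  have hX : (Polynomial.X : Polynomial ℂ).natDegree ≤ n := by rw [Polynomial.natDegree_X]; omega
  have h1 : (1 : Polynomial ℂ).natDegree ≤ n := by rw [Polynomial.natDegree_one]; omega
  have hRδ : ∀ δ : ℂ, p + δ • Polynomial.X - Polynomial.X * (q + δ • (1 : Polynomial ℂ)) =
      p - Polynomial.X * q := fun δ => by
    rw [mul_add, mul_smul_comm, mul_one]
    abel
  have evq : ∀ᶠ δ : ℝ in 𝓝[≠] 0, ∀ z ∈ (p - Polynomial.X * q).roots.toFinset,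
      q.eval z + δ • (1 : ℂ) ≠ 0 := by
    rw [Filter.eventually_all_finset]
    exact fun z _ => eventually_add_smul_ne_zero (Or.inr one_ne_zero)
  rw [← closure_closure]
  refine mem_closure_of_eventually (Y := homogenizeVF n Polynomial.X 1) hF ?_
  filter_upwards [evq] with δ hδ
  rw [← homogenizeVF_add_smul]
  have hpδ := natDegree_add_smul_le hp hX δ
  have hqδ := natDegree_add_smul_le hq h1 δ
  have hrep := represents_mk (homogenizeVF_ne_zero hpδ hqδ (by rwa [hRδ]))
  refine ⟨_, mem_closure_of_eval_ne_zero hn hpδ hqδ (by rwa [hRδ]) (by rwa [hRδ]) ?_ hrep, hrep⟩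
  intro z hz
  rw [hRδ] at hz
  have := hδ z (by rwa [Multiset.mem_toFinset, Polynomial.mem_roots hR0])
  rwa [Polynomial.eval_add, Polynomial.eval_smul, Polynomial.eval_one, smul_eq_mul,
    ← Complex.real_smul]

/-- Adding δ (-c, -X^n) to (p, q) adds δ (X^(n+1) - c) to p - X q, which yields n + 1 ≥ 3 distinct
roots. -/
theorem homogeneousFoliations_subset_closure (hn : 2 ≤ n) :
    homogeneousFoliations n ⊆ closure (goodSet n ∩ homogeneousFoliations n) := by
  rintro F ⟨-, X, hF, h1, h2⟩
  obtain ⟨p, q, hp, hq, rfl⟩ := exists_eq_homogenizeVF h1 h2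
  have hdeg : (p - Polynomial.X * q).natDegree ≤ n + 1 := by
    refine (Polynomial.natDegree_sub_le_of_le (hp.trans n.le_succ) ?_).trans (max_self _).le
    refine Polynomial.natDegree_mul_le.trans ?_
    rw [Polynomial.natDegree_X]
    omega
  obtain ⟨c, hc⟩ := eventually_simple_roots n (by omega) _ hdeg
  have hRδ : ∀ δ : ℂ, p + δ • (-Polynomial.C c) - Polynomial.X * (q + δ • (-Polynomial.X ^ n)) =
      p - Polynomial.X * q + δ • (Polynomial.X ^ (n + 1) - Polynomial.C c) := fun δ => by
    simp only [Polynomial.smul_eq_C_mul]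
    ring
  have hC : (-Polynomial.C c).natDegree ≤ n := by simp
  have hX : (-Polynomial.X ^ n : Polynomial ℂ).natDegree ≤ n := by simp
  rw [← closure_closure]
  refine mem_closure_of_eventually
    (Y := homogenizeVF n (-Polynomial.C c) (-Polynomial.X ^ n)) hF ?_
  filter_upwards [hc] with δ hδ
  rw [← homogenizeVF_add_smul]
  rw [← hRδ] at hδ
  have hpδ := natDegree_add_smul_le hp hC δ
  have hqδ := natDegree_add_smul_le hq hX δ
  have hrep := represents_mk (homogenizeVF_ne_zero hpδ hqδ (ne_zero_of_natDegree_eq hδ.1))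
  exact ⟨_, mem_closure_of_card_roots (by omega) hpδ hqδ hδ.1 (by rw [hδ.2]; omega) hrep, hrep⟩

end density

end PolyFol

end

theorem mainTheorem4 (n : ℕ) (hn : 2 ≤ n) :
    ∃ U : Set (PolyFol.homogeneousFoliations n), IsOpen U ∧ Dense U ∧
      ∀ F ∈ U, ∀ X : PolyFol.VF n, PolyFol.Represents X (F : PolyFol.ProjVF n) →
        {L : Set (ℂ × ℂ) | PolyFol.IsLeaf (X.1 : PolyFol.Poly) (X.2 : PolyFol.Poly) L ∧
          ¬ PolyFol.HasInfiniteGenus (X.1 : PolyFol.Poly) (X.2 : PolyFol.Poly) L}.Finite := by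
  refine ⟨(↑) ⁻¹' PolyFol.goodSet n, (PolyFol.isOpen_goodSet n).preimage continuous_subtype_val,
    ?_, ?_⟩
  · rw [Subtype.dense_iff, Subtype.image_preimage_coe, Set.inter_comm]
    exact PolyFol.homogeneousFoliations_subset_closure hn
  · intro F hF X hX
    obtain ⟨-, Y, hY, h1, h2⟩ := F.2
    obtain ⟨z₀, d, h⟩ := PolyFol.isGoodContour_of_mem_goodSet hX hF
    obtain ⟨a, -, rfl⟩ := PolyFol.exists_smul_of_represents hY hX
    refine h.finite_leaves (n := n) (by omega) ?_ ?_
    · exact (MvPolynomial.homogeneousSubmodule (Fin 2) ℂ n).smul_mem a h1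
    · exact (MvPolynomial.homogeneousSubmodule (Fin 2) ℂ n).smul_mem a h2
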